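/- Let $n\in\mathbb N$, $a<b$, $\mathcal J=\begin{pmatrix}0&I\\-I&0\end{pmatrix}\in\mathbb R^{2n\times 2n}$ and $E=\begin{pmatrix}0\\I\end{pmatrix}\in\mathbb R^{2n\times n}$. A matrix $S\in\mathbb R^{2n\times2n}$ is symplectic if $S^T\mathcal JS=\mathcal J$. A continuous Lagrangian path on $[a,b]$ is a continuous $Y=\begin{pmatrix}X\\U\end{pmatrix}:[a,b]\to\mathbb R^{2n\times n}$ with $Y^T(t)\mathcal JY(t)=0$ and $\operatorname{rank}Y(t)=n$ for all $t\in[a,b]$. For $Y=\begin{pmatrix}X\\U\end{pmatrix}$, $\hat Y=\begin{pmatrix}\hat X\\\hat U\end{pmatrix}\in\mathbb R^{2n\times n}$ with $Y^T\mathcal JY=0=\hat Y^T\mathcal J\hat Y$ and $\operatorname{rank}Y=\operatorname{rank}\hat Y=n$, put $W=Y^T\mathcal J\hat Y$, $\mathcal M=(I-X^\dagger X)W$, $V=I-\mathcal M^\dagger\mathcal M$, $\mathcal P=VW^TX^\dagger\hat XV$, where $^\dagger$ is the Moore--Penrose pseudoinverse. The comparative index and the dual comparative index are $\mu(Y,\hat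 Y)=\operatorname{rank}\mathcal M+\operatorname{ind}\mathcal P$ and $\mu^*(Y,\hat Y)=\operatorname{rank}\mathcal M+\operatorname{ind}(-\mathcal P)$, where $\operatorname{ind}$ is the number of negative eigenvalues, counted with multiplicity. For a continuous Lagrangian path $Y$ on $[a,b]$, admissible data are a partition $a=t_0<t_1<\dots<t_p=b$ and symplectic matrices $R_k(t)$, $t\in[a,b]$, $k=0,\dots,p-1$, such that for every $k$ the function $R_k$ is continuous on $[t_k,t_{k+1}]$ and on this interval the rank of the upper $n\times n$ block of $R_k^{-1}(t)Y(t)$ and the rank of the upper $n\times n$ block of $R_k(t)E$ are constant. The oscillation number $\mathcal N(Y)$ of $Y$ on $[a,b]$ and the dual oscillation number $\mathcal N^*(Y)$ are the numbers $$\mathcal N(Y)=\sum_{k=0}^{p-1}\Big(\mu\big(Y(t_{k+1}),R_k(t_{k+1})E\big)-\mu\big(Y(t_k),R_k(t_k)E\big)\Big),$$ $$\mathcal N^*(Y)=\sum_{k=0}^{p-1}\Big(\mu^*\big(Y(t_k),R_k(t_k)E\big)-\mu^*\big(Y(t_{k+1}),R_k(t_{k+1})E\big)\Big);$$ they are well defined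 if admissible data exist and the sums do not depend on their choice. For $Y\in\mathbb R^{2n\times n}$ with $Y^T\mathcal JY=0$ and $\operatorname{rank}Y=n$ let $K_Y=(Y^TY)^{-1/2}$ and $Z_Y=\begin{pmatrix}\mathcal JYK_Y&YK_Y\end{pmatrix}\in\mathbb R^{2n\times2n}$. **Theorem.** Let $Y$ be a continuous Lagrangian path on $[a,b]$ and let $S:[a,b]\to\mathbb R^{2n\times2n}$ be continuous with $S(t)$ symplectic for all $t\in[a,b]$. Put $Z_{SE}(t)=Z_{S(t)E}$. Then $Z_{SE}(t)$ is symplectic and orthogonal for all $t\in[a,b]$, $S^{-1}Y$ and $Z_{SE}^{-1}Y$ are continuous Lagrangian paths on $[a,b]$, their oscillation numbers and dual oscillation numbers are well defined, and $$\mathcal N(S^{-1}Y)=\mathcal N(Z_{SE}^{-1}Y),\qquad \mathcal N^*(S^{-1}Y)=\mathcal N^*(Z_{SE}^{-1}Y).$$ -/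

import Mathlib

open Matrix

noncomputable section

namespace Osc

/-! Real matrices of size `2n × n` and `2n × 2n`, with block index `Fin n ⊕ Fin n`. -/

/-- Matrices `Y = (Xᵀ Uᵀ)ᵀ ∈ ℝ^{2n × n}`. -/
abbrev Tall (n : ℕ) := Matrix (Fin n ⊕ Fin n) (Fin n) ℝ

/-- Matrices in `ℝ^{2n × 2n}`. -/
abbrev Big (n : ℕ) := Matrix (Fin n ⊕ Fin n) (Fin n ⊕ Fin n) ℝ

/-- The canonical skew-symmetric matrix `𝒥 = (0 I; -I 0)`. It is the negative of `Matrix.J`, so that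
`Sᵀ 𝒥 S = 𝒥` is membership in Mathlib's `Matrix.symplecticGroup`. -/
def calJ (n : ℕ) : Big n := fromBlocks 0 1 (-1) 0

/-- The vertical Lagrangian plane `E = (0 I)ᵀ`. -/
def vertE (n : ℕ) : Tall n := fromRows 0 1

/-- The upper block `X` of `Y = (Xᵀ Uᵀ)ᵀ`. -/
def upper {n : ℕ} (Y : Tall n) : Matrix (Fin n) (Fin n) ℝ := Y.toRows₁

/-- The Wronskian `W(Y, Ŷ) = Yᵀ 𝒥 Ŷ`. -/
def wronskian {n : ℕ} (Y Yh : Tall n) : Matrix (Fin n) (Fin n) ℝ := Yᵀ * calJ n * Yh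

/-- Constant Lagrangian planes. -/
def IsLagrangian {n : ℕ} (Y : Tall n) : Prop := Yᵀ * calJ n * Y = 0 ∧ Y.rank = n

/-- The four Penrose equations for real square matrices. -/
structure IsPenroseInverse {n : ℕ} (A B : Matrix (Fin n) (Fin n) ℝ) : Prop where
  mul_mul_left : A * B * A = A
  mul_mul_right : B * A * B = B
  symm_left : (A * B)ᵀ = A * B
  symm_right : (B * A)ᵀ = B * A

theorem IsPenroseInverse.unique {n : ℕ} {A B C : Matrix (Fin n) (Fin n) ℝ}
    (hB : IsPenroseInverse A B) (hC : IsPenroseInverse A C) : B = C := by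
  have h1 : A * B = A * C := by
    calc A * B = (A * B)ᵀ := hB.symm_left.symm
      _ = ((A * C) * (A * B))ᵀ := by
        rw [← Matrix.mul_assoc (A * C) A B, hC.mul_mul_left]
      _ = (A * B)ᵀ * (A * C)ᵀ := by rw [Matrix.transpose_mul (A * C)]
      _ = (A * B) * (A * C) := by rw [hB.symm_left, hC.symm_left]
      _ = A * C := by rw [← Matrix.mul_assoc, hB.mul_mul_left]
  have h2 : B * A = C * A := by
    calc B * A = (B * A)ᵀ := hB.symm_right.symm
      _ = ((B * A) * (C * A))ᵀ := by
        rw [Matrix.mul_assoc B A (C * A), ← Matrix.mul_assoc A C A, hC.mul_mul_left]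
      _ = (C * A)ᵀ * (B * A)ᵀ := by rw [Matrix.transpose_mul (B * A)]
      _ = (C * A) * (B * A) := by rw [hB.symm_right, hC.symm_right]
      _ = C * A := by rw [Matrix.mul_assoc, ← Matrix.mul_assoc A, hB.mul_mul_left]
  calc B = B * A * B := hB.mul_mul_right.symm
    _ = C * (A * B) := by rw [h2, Matrix.mul_assoc]
    _ = C := by rw [h1, ← Matrix.mul_assoc, hC.mul_mul_right]

/-- Diagonalizing `AᵀA = U diag(d) Uᵀ`, the matrix `U diag(d⁻¹) Uᵀ Aᵀ` (with `0⁻¹ = 0`) satisfies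
the Penrose equations. -/
theorem exists_isPenroseInverse {n : ℕ} (A : Matrix (Fin n) (Fin n) ℝ) :
    ∃ B, IsPenroseInverse A B := by
  have hH : (Aᵀ * A).IsHermitian := by
    simpa using Matrix.isHermitian_conjTranspose_mul_self A
  obtain ⟨U, d, hU, hA⟩ : ∃ (U : Matrix (Fin n) (Fin n) ℝ) (d : Fin n → ℝ),
      Uᵀ * U = 1 ∧ Aᵀ * A = U * diagonal d * Uᵀ := by
    refine ⟨hH.eigenvectorUnitary, hH.eigenvalues, ?_, ?_⟩
    · have := (Matrix.mem_unitaryGroup_iff').1 hH.eigenvectorUnitary.2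
      simpa [star_eq_conjTranspose] using this
    · have := hH.spectral_theorem
      simpa [Unitary.conjStarAlgAut_apply, star_eq_conjTranspose, Function.comp_def] using this
  have key : ∀ e f : Fin n → ℝ, (U * diagonal e * Uᵀ) * (U * diagonal f * Uᵀ)
      = U * diagonal (fun i => e i * f i) * Uᵀ := by
    intro e f
    calc (U * diagonal e * Uᵀ) * (U * diagonal f * Uᵀ)
        = U * diagonal e * (Uᵀ * U) * diagonal f * Uᵀ := by simp only [Matrix.mul_assoc]
      _ = _ := by rw [hU, Matrix.mul_one, Matrix.mul_assoc U, diagonal_mul_diagonal]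
  set G := U * diagonal (fun i => (d i)⁻¹) * Uᵀ with hG
  have hGs : Gᵀ = G := by simp [hG, Matrix.mul_assoc]
  have hGA : G * (Aᵀ * A) = U * diagonal (fun i => (d i)⁻¹ * d i) * Uᵀ := by rw [hA, hG, key]
  have hAGA : (Aᵀ * A) * (G * (Aᵀ * A)) = Aᵀ * A := by
    rw [hGA, hA, key]
    congr 3; funext i
    by_cases h : d i = 0 <;> simp [h]
  have hGAG : G * (Aᵀ * A) * G = G := by
    rw [hGA, hG, key]
    congr 3; funext i
    by_cases h : d i = 0 <;> simp [h]
  refine ⟨G * Aᵀ, ?_, ?_, ?_, ?_⟩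
  · have h0 : A * (G * (Aᵀ * A)) - A = A * (G * (Aᵀ * A) - 1) := by
      rw [Matrix.mul_sub, Matrix.mul_one]
    have h1 : (Aᵀ * A) * (G * (Aᵀ * A) - 1) = 0 := by
      rw [Matrix.mul_sub, hAGA, Matrix.mul_one, sub_self]
    have h2 : A * (G * (Aᵀ * A) - 1) = 0 := by
      have := (Matrix.conjTranspose_mul_self_mul_eq_zero A (G * (Aᵀ * A) - 1)).1 (by simpa using h1)
      exact this
    rw [h2] at h0
    rw [Matrix.mul_assoc, Matrix.mul_assoc]
    exact sub_eq_zero.1 h0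
  · calc G * Aᵀ * A * (G * Aᵀ) = (G * (Aᵀ * A) * G) * Aᵀ := by simp only [Matrix.mul_assoc]
      _ = G * Aᵀ := by rw [hGAG]
  · simp [Matrix.transpose_mul, hGs, Matrix.mul_assoc]
  · rw [Matrix.mul_assoc, hGA]
    simp [Matrix.transpose_mul, Matrix.mul_assoc]

/-- The Moore–Penrose pseudoinverse `A†`. -/
def pinv {n : ℕ} (A : Matrix (Fin n) (Fin n) ℝ) : Matrix (Fin n) (Fin n) ℝ :=
  Classical.choose (exists_isPenroseInverse A)

theorem pinv_spec {n : ℕ} (A : Matrix (Fin n) (Fin n) ℝ) : IsPenroseInverse A (pinv A) :=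
  Classical.choose_spec (exists_isPenroseInverse A)

/-- `ind P`: the number of negative eigenvalues (with multiplicity) of a symmetric matrix `P`. -/
def ind {n : ℕ} (P : Matrix (Fin n) (Fin n) ℝ) : ℕ :=
  (P.charpoly.roots.filter (fun x => x < 0)).card

/-- `ℳ = (I - X†X) W(Y, Ŷ)`. -/
def calM {n : ℕ} (Y Yh : Tall n) : Matrix (Fin n) (Fin n) ℝ :=
  (1 - pinv (upper Y) * upper Y) * wronskian Y Yh

/-- `V = I - ℳ†ℳ`. -/
def calV {n : ℕ} (Y Yh : Tall n) : Matrix (Fin n) (Fin n) ℝ :=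
  1 - pinv (calM Y Yh) * calM Y Yh

/-- `𝒫 = V W(Y, Ŷ)ᵀ X† X̂ V`. -/
def calP {n : ℕ} (Y Yh : Tall n) : Matrix (Fin n) (Fin n) ℝ :=
  calV Y Yh * (wronskian Y Yh)ᵀ * pinv (upper Y) * upper Yh * calV Y Yh

/-- The comparative index `μ(Y, Ŷ) = rank ℳ + ind 𝒫`. -/
def compIndex {n : ℕ} (Y Yh : Tall n) : ℕ := (calM Y Yh).rank + ind (calP Y Yh)

/-- The dual comparative index `μ*(Y, Ŷ) = rank ℳ + ind (-𝒫)`. -/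
def dualCompIndex {n : ℕ} (Y Yh : Tall n) : ℕ := (calM Y Yh).rank + ind (-calP Y Yh)

/-- Continuous Lagrangian paths on `[a, b]`. -/
def IsLagrangianPath {n : ℕ} (a b : ℝ) (Y : ℝ → Tall n) : Prop :=
  ContinuousOn Y (Set.Icc a b) ∧ ∀ t ∈ Set.Icc a b, IsLagrangian (Y t)

/-- A partition `a = t₀ < t₁ < ⋯ < t_p = b` and a system of symplectic matrices `R_k(t)`, continuous on
`[t_k, t_{k+1}]`, such that on `[t_k, t_{k+1}]` the rank of the upper block of `R_k⁻¹ Y` and the rank of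
the upper block of `R_k E` are constant. -/
structure IsAdmissible {n : ℕ} (a b : ℝ) (Y : ℝ → Tall n) {p : ℕ} (τ : Fin (p + 1) → ℝ)
    (R : Fin p → ℝ → Big n) : Prop where
  first : τ 0 = a
  last : τ (Fin.last p) = b
  strictMono : StrictMono τ
  symplectic : ∀ k, ∀ t ∈ Set.Icc a b, R k t ∈ symplecticGroup (Fin n) ℝ
  continuousOn : ∀ k, ContinuousOn (R k) (Set.Icc (τ k.castSucc) (τ k.succ))
  rank_transformed : ∀ k, ∃ r : ℕ, ∀ t ∈ Set.Icc (τ k.castSucc) (τ k.succ),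
    (upper ((R k t)⁻¹ * Y t)).rank = r
  rank_upper : ∀ k, ∃ r : ℕ, ∀ t ∈ Set.Icc (τ k.castSucc) (τ k.succ),
    (upper (R k t * vertE n)).rank = r

/-- `𝒩(Y, D, R) = ∑ₖ (μ(Y(t), R_k(t)E) at t_{k+1} minus its value at t_k)`. -/
def oscSum {n : ℕ} (Y : ℝ → Tall n) {p : ℕ} (τ : Fin (p + 1) → ℝ) (R : Fin p → ℝ → Big n) : ℤ :=
  ∑ k : Fin p,
    ((compIndex (Y (τ k.succ)) (R k (τ k.succ) * vertE n) : ℤ)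
      - (compIndex (Y (τ k.castSucc)) (R k (τ k.castSucc) * vertE n) : ℤ))

/-- `𝒩*(Y, D, R) = ∑ₖ (μ*(Y(t), R_k(t)E) at t_k minus its value at t_{k+1})`. -/
def dualOscSum {n : ℕ} (Y : ℝ → Tall n) {p : ℕ} (τ : Fin (p + 1) → ℝ)
    (R : Fin p → ℝ → Big n) : ℤ :=
  ∑ k : Fin p,
    ((dualCompIndex (Y (τ k.castSucc)) (R k (τ k.castSucc) * vertE n) : ℤ)
      - (dualCompIndex (Y (τ k.succ)) (R k (τ k.succ) * vertE n) : ℤ))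

/-- `N` is the oscillation number of the continuous Lagrangian path `Y` on `[a, b]`: admissible partitions
with symplectic systems exist, and `𝒩(Y, D, R) = N` for every one of them. -/
structure IsOscillationNumber {n : ℕ} (a b : ℝ) (Y : ℝ → Tall n) (N : ℤ) : Prop where
  path : IsLagrangianPath a b Y
  exists_admissible : ∃ (p : ℕ) (τ : Fin (p + 1) → ℝ) (R : Fin p → ℝ → Big n), IsAdmissible a b Y τ R
  eq_sum : ∀ (p : ℕ) (τ : Fin (p + 1) → ℝ) (R : Fin p → ℝ → Big n),
    IsAdmissible a b Y τ R → oscSum Y τ R = N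

/-- `N` is the dual oscillation number of the continuous Lagrangian path `Y` on `[a, b]`. -/
structure IsDualOscillationNumber {n : ℕ} (a b : ℝ) (Y : ℝ → Tall n) (N : ℤ) : Prop where
  path : IsLagrangianPath a b Y
  exists_admissible : ∃ (p : ℕ) (τ : Fin (p + 1) → ℝ) (R : Fin p → ℝ → Big n), IsAdmissible a b Y τ R
  eq_sum : ∀ (p : ℕ) (τ : Fin (p + 1) → ℝ) (R : Fin p → ℝ → Big n),
    IsAdmissible a b Y τ R → dualOscSum Y τ R = N

open scoped MatrixOrder in
/-- `K_Y = (YᵀY)^{-1/2}`: the inverse of the positive square root. -/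
def normK {n : ℕ} (Y : Tall n) : Matrix (Fin n) (Fin n) ℝ := (CFC.sqrt (Yᵀ * Y))⁻¹

/-- `Z_Y = (𝒥 Y K_Y   Y K_Y)`. -/
def matZ {n : ℕ} (Y : Tall n) : Big n := fromCols (calJ n * Y * normK Y) (Y * normK Y)

end Osc

end

noncomputable section

namespace Osc

open Filter Topology

/-! ### Inertia of symmetric matrices and generalized Schur complements. -/

section Inertia

/-! For all but finitely many real `σ` the matrix `D = U - σX` is invertible, and the plane of `Y`
is described by the symmetric matrix `A = X D⁻¹`. Let `B` and `D̂` be the analogous matrices of `Ŷ`.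
The Wronskian is `W = Dᵀ (A - B) D̂`. The heart of the proof is the identity `ind A + μ(Y, Ŷ) = ind
B + ind (A - B)` (`negIndex_chart_add_compIndex`), obtained by computing the negative index of one
block matrix, with diagonal blocks `Dᵀ A D`, `D̂ᵀ (A - B) D̂` and off-diagonal block `W`, in two
ways. The generalized Schur complement yields the left side, since `ℳ` and `𝒫` are exactly what it
leaves over; a congruence to `diag(B, A - B)` yields the right side. Multiplying all forms by `ε =
±1` treats `μ` and `μ*` together.

With `Ŷ = R E`, the two rank conditions on admissible data say that `B` and `A - B` have constant
rank. Their inertia is then locally constant by semicontinuity, so `μ(Y, R E)` has locally the same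
increments as `-ind A`, which does not involve `R`. Gluing over the partition and connectedness of
`[a, b]` give independence of the data (`IsAdmissible.signedSum_eq`). Data exist because constant
planes `(I σI)ᵀ` serve on short intervals (`exists_isAdmissible`).

For the comparison put `G = S⁻¹ Z_{SE}`. Since `Z_{SE} E = S E K`, one has `G E = E K`, so `G` is
lower block triangular. Such matrices preserve the comparative index (`signedIndex_mul`) and carry
admissible data `R` of `Z_{SE}⁻¹ Y` to admissible data `G R` of `G Z_{SE}⁻¹ Y = S⁻¹ Y`. The two sums
agree term by term. -/

theorem dotProduct_congr_mulVec {ι κ : Type*} [Fintype ι] [Fintype κ]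
    (C : Matrix κ ι ℝ) (P : Matrix κ κ ℝ) (x : ι → ℝ) :
    x ⬝ᵥ (Cᵀ * P * C) *ᵥ x = (C *ᵥ x) ⬝ᵥ P *ᵥ (C *ᵥ x) := by
  rw [← mulVec_mulVec, ← mulVec_mulVec, dotProduct_mulVec, vecMul_transpose]

theorem isSymm_fromBlocks_transpose {ι κ : Type*}
    {A : Matrix ι ι ℝ} {N : Matrix ι κ ℝ} {C : Matrix κ κ ℝ}
    (hA : A.IsSymm) (hC : C.IsSymm) : (fromBlocks A N Nᵀ C).IsSymm := by
  rw [Matrix.isSymm_fromBlocks_iff]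
  exact ⟨hA, by simp, rfl, hC⟩

variable {ι κ : Type*} [Fintype ι] [Fintype κ] [DecidableEq ι] [DecidableEq κ]

/-- The negative index of inertia of the quadratic form `x ↦ xᵀ P x`. -/
def negIndex (P : Matrix ι ι ℝ) : ℕ := sigNeg P.toQuadraticForm'

theorem toQuadraticForm'_eq (P : Matrix ι ι ℝ) (x : ι → ℝ) :
    P.toQuadraticForm' x = x ⬝ᵥ P *ᵥ x := by
  simp [Matrix.toQuadraticForm', Matrix.toLinearMap₂'_apply', LinearMap.BilinMap.toQuadraticMap_apply]

theorem negIndex_eq_of_equiv (e : (ι → ℝ) ≃ₗ[ℝ] (κ → ℝ)) {P : Matrix ι ι ℝ} {Q : Matrix κ κ ℝ}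
    (h : ∀ x, e x ⬝ᵥ Q *ᵥ e x = x ⬝ᵥ P *ᵥ x) : negIndex P = negIndex Q :=
  QuadraticMap.Equivalent.sigNeg_eq
    ⟨⟨e, fun x => by
      have := h x
      rw [← toQuadraticForm'_eq, ← toQuadraticForm'_eq] at this
      exact this⟩⟩

/-- Sylvester's law of inertia. -/
theorem negIndex_congr {C : Matrix ι ι ℝ} (hC : IsUnit C.det) (P : Matrix ι ι ℝ) :
    negIndex (Cᵀ * P * C) = negIndex P := by
  have hu := (Matrix.isUnit_iff_isUnit_det C).2 hC
  refine negIndex_eq_of_equiv (C.toLinearEquiv' hu.invertible) fun x => ?_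
  rw [dotProduct_congr_mulVec]
  rfl

theorem negIndex_congr_of_mul_eq_one {C D : Matrix ι ι ℝ} (h : C * D = 1) (P : Matrix ι ι ℝ) :
    negIndex (Cᵀ * P * C) = negIndex P :=
  negIndex_congr (Matrix.isUnit_det_of_right_inverse h) P

theorem negIndex_diagonal (d : ι → ℝ) :
    negIndex (diagonal d) = (Finset.univ.filter fun i => d i < 0).card := by
  have : (diagonal d).toQuadraticForm' = QuadraticMap.weightedSumSquares ℝ d := by
    ext x
    rw [toQuadraticForm'_eq, QuadraticMap.weightedSumSquares_apply]
    simp only [dotProduct, mulVec_diagonal, smul_eq_mul]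
    exact Finset.sum_congr rfl fun i _ => by ring
  rw [negIndex, this, QuadraticForm.sigNeg_weightedSumSquares, Set.ncard_eq_toFinset_card']
  simp

theorem exists_diagonalization {P : Matrix ι ι ℝ} (hP : P.IsSymm) :
    ∃ (U : Matrix ι ι ℝ) (d : ι → ℝ), U * Uᵀ = 1 ∧ Uᵀ * U = 1 ∧ P = U * diagonal d * Uᵀ := by
  have hH : P.IsHermitian := by rw [Matrix.IsHermitian, conjTranspose_eq_transpose_of_trivial, hP.eq]
  have h1 : (hH.eigenvectorUnitary : Matrix ι ι ℝ)ᵀ * hH.eigenvectorUnitary = 1 := by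
    have := (Matrix.mem_unitaryGroup_iff').1 hH.eigenvectorUnitary.2
    simpa [star_eq_conjTranspose] using this
  refine ⟨hH.eigenvectorUnitary, hH.eigenvalues, mul_eq_one_comm.1 h1, h1, ?_⟩
  have := hH.spectral_theorem
  simpa [Unitary.conjStarAlgAut_apply, star_eq_conjTranspose, Function.comp_def] using this

theorem negIndex_conj_orthogonal {U : Matrix ι ι ℝ} (hU : U * Uᵀ = 1) (P : Matrix ι ι ℝ) :
    negIndex (U * P * Uᵀ) = negIndex P := by
  have := negIndex_congr_of_mul_eq_one (mul_eq_one_comm.1 hU) P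
  rwa [transpose_transpose] at this

theorem negIndex_add_negIndex_neg {P : Matrix ι ι ℝ} (hP : P.IsSymm) :
    negIndex P + negIndex (-P) = P.rank := by
  obtain ⟨U, d, hU, hU', rfl⟩ := exists_diagonalization hP
  have h1 : -(U * diagonal d * Uᵀ) = U * diagonal (-d) * Uᵀ := by
    rw [← Matrix.neg_mul, ← Matrix.mul_neg, diagonal_neg]; rfl
  have hd : IsUnit U.det := Matrix.isUnit_det_of_right_inverse hU
  have hd' : IsUnit Uᵀ.det := Matrix.isUnit_det_of_right_inverse hU'
  rw [h1, negIndex_conj_orthogonal hU, negIndex_conj_orthogonal hU, negIndex_diagonal,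
    negIndex_diagonal, rank_mul_eq_left_of_isUnit_det _ _ hd', rank_mul_eq_right_of_isUnit_det _ _ hd,
    rank_diagonal, Fintype.card_subtype, ← Finset.card_union_of_disjoint]
  · congr 1
    ext i
    simp [lt_or_lt_iff_ne]
  · rw [Finset.disjoint_filter]
    intro i _ h
    simpa using h.le

/-- Passes from eigenvalues to quadratic forms, where congruences by non-orthogonal matrices are
allowed. -/
theorem ind_eq_negIndex {n : ℕ} {P : Matrix (Fin n) (Fin n) ℝ} (hP : P.IsSymm) :
    ind P = negIndex P := by
  obtain ⟨U, d, hU, hU', rfl⟩ := exists_diagonalization hP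
  rw [negIndex_conj_orthogonal hU, negIndex_diagonal, ind, Matrix.mul_assoc, charpoly_mul_comm,
    Matrix.mul_assoc, hU', Matrix.mul_one, charpoly_diagonal, Polynomial.roots_prod _ _
      (Finset.prod_ne_zero_iff.2 fun i _ => Polynomial.X_sub_C_ne_zero _)]
  have h : (Finset.univ.val.bind fun i => (Polynomial.X - Polynomial.C (d i)).roots) =
      Finset.univ.val.map d := by
    simp [Polynomial.roots_X_sub_C, Multiset.bind_singleton]
  rw [h, Multiset.filter_map, Multiset.card_map]
  rfl

theorem negIndex_fromBlocks_diagonal {P : Matrix ι ι ℝ} {Q : Matrix κ κ ℝ}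
    (hP : P.IsSymm) (hQ : Q.IsSymm) :
    negIndex (fromBlocks P 0 0 Q) = negIndex P + negIndex Q := by
  obtain ⟨U, d, hU, hU', rfl⟩ := exists_diagonalization hP
  obtain ⟨V, e, hV, hV', rfl⟩ := exists_diagonalization hQ
  have h1 : fromBlocks (U * diagonal d * Uᵀ) 0 0 (V * diagonal e * Vᵀ) =
      fromBlocks U 0 0 V * diagonal (Sum.elim d e) * (fromBlocks U 0 0 V)ᵀ := by
    rw [← fromBlocks_diagonal]
    rw [fromBlocks_transpose, fromBlocks_multiply, fromBlocks_multiply]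
    simp
  have h2 : fromBlocks U 0 0 V * (fromBlocks U 0 0 V)ᵀ = 1 := by
    simp [fromBlocks_multiply, fromBlocks_transpose, hU, hV]
  rw [h1, negIndex_conj_orthogonal h2, negIndex_conj_orthogonal hU, negIndex_conj_orthogonal hV,
    negIndex_diagonal, negIndex_diagonal, negIndex_diagonal]
  simp only [Finset.card_filter, Fintype.sum_sum_type, Sum.elim_inl, Sum.elim_inr]
  congr!

theorem rank_fromBlocks_diagonal {P : Matrix ι ι ℝ} {Q : Matrix κ κ ℝ}
    (hP : P.IsSymm) (hQ : Q.IsSymm) : (fromBlocks P 0 0 Q).rank = P.rank + Q.rank := by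
  have hs : (fromBlocks P 0 0 Q).IsSymm := by
    rw [Matrix.isSymm_fromBlocks_iff]
    exact ⟨hP, by simp, by simp, hQ⟩
  have h := negIndex_fromBlocks_diagonal hP.neg hQ.neg
  rw [← negIndex_add_negIndex_neg hs, fromBlocks_neg, neg_zero, neg_zero, h,
    negIndex_fromBlocks_diagonal hP hQ, ← negIndex_add_negIndex_neg hP,
    ← negIndex_add_negIndex_neg hQ]
  ring

theorem negIndex_zero : negIndex (0 : Matrix ι ι ℝ) = 0 := by
  rw [← diagonal_zero, negIndex_diagonal]; simp

/-- An orthogonal projection onto the range of a symmetric matrix. -/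
theorem exists_range_projection {P : Matrix ι ι ℝ} (hP : P.IsSymm) :
    ∃ E : Matrix ι ι ℝ, Eᵀ = E ∧ E * E = E ∧ P * E = P ∧ ∃ D, E = D * P := by
  obtain ⟨U, d, hU, hU', rfl⟩ := exists_diagonalization hP
  have key : ∀ e f : ι → ℝ, (U * diagonal e * Uᵀ) * (U * diagonal f * Uᵀ)
      = U * diagonal (fun i => e i * f i) * Uᵀ := by
    intro e f
    calc (U * diagonal e * Uᵀ) * (U * diagonal f * Uᵀ)
        = U * diagonal e * (Uᵀ * U) * diagonal f * Uᵀ := by simp only [Matrix.mul_assoc]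
      _ = _ := by rw [hU', Matrix.mul_one, Matrix.mul_assoc U, diagonal_mul_diagonal]
  refine ⟨U * diagonal (fun i => (d i)⁻¹ * d i) * Uᵀ, by simp [Matrix.mul_assoc], ?_, ?_,
    U * diagonal (fun i => (d i)⁻¹) * Uᵀ, (key _ _).symm⟩
  · rw [key]
    congr 3; funext i
    by_cases h : d i = 0 <;> simp [h]
  · rw [key]
    congr 3; funext i
    by_cases h : d i = 0 <;> simp [h]

theorem negIndex_add_of_mul_eq_zero {P Q : Matrix ι ι ℝ} (hP : P.IsSymm) (hQ : Q.IsSymm)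
    (h : P * Q = 0) : negIndex (P + Q) = negIndex P + negIndex Q := by
  obtain ⟨E, hEt, hEE, hQE, D, hD⟩ := exists_range_projection hQ
  have hQP : Q * P = 0 := by
    have := congrArg transpose h
    rwa [transpose_mul, hP.eq, hQ.eq, transpose_zero] at this
  have hEP : E * P = 0 := by rw [hD, Matrix.mul_assoc, hQP, Matrix.mul_zero]
  have hPE : P * E = 0 := by
    have := congrArg transpose hEP
    rwa [transpose_mul, hP.eq, hEt, transpose_zero] at this
  have hEQ : E * Q = Q := by
    have := congrArg transpose hQE
    rwa [transpose_mul, hQ.eq, hEt] at this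
  -- `O` is an orthogonal involution on two copies of the space: it fixes the range of `P` in the
  -- first copy and moves the range of `Q` into the second.
  let O : Matrix (ι ⊕ ι) (ι ⊕ ι) ℝ := fromBlocks (1 - E) E E (1 - E)
  have hOt : Oᵀ = O := by simp [O, fromBlocks_transpose, hEt]
  have hOO : O * O = 1 := by
    simp [O, fromBlocks_multiply, Matrix.mul_sub, Matrix.sub_mul, hEE]
  have hc : Oᵀ * fromBlocks (P + Q) 0 0 0 * O = fromBlocks P 0 0 Q := by
    rw [hOt]
    simp [O, fromBlocks_multiply, Matrix.mul_sub, Matrix.sub_mul, Matrix.mul_add, hEP, hPE, hEQ, hQE]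
  rw [← negIndex_fromBlocks_diagonal hP hQ, ← hc, negIndex_congr_of_mul_eq_one hOO,
    negIndex_fromBlocks_diagonal (hP.add hQ) (by simp [Matrix.IsSymm]), negIndex_zero, add_zero]

theorem rank_fromBlocks_antidiagonal (N : Matrix ι κ ℝ) :
    (fromBlocks (0 : Matrix ι ι ℝ) N Nᵀ 0).rank = N.rank + N.rank := by
  rw [← rank_self_mul_transpose]
  have h : fromBlocks (0 : Matrix ι ι ℝ) N Nᵀ 0 * (fromBlocks 0 N Nᵀ 0)ᵀ =
      fromBlocks (N * Nᵀ) 0 0 (Nᵀ * N) := by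
    simp [fromBlocks_multiply, fromBlocks_transpose]
  rw [h, rank_fromBlocks_diagonal (by simp [Matrix.IsSymm]) (by simp [Matrix.IsSymm]),
    rank_self_mul_transpose, rank_transpose_mul_self]

/-- Changing the sign of one summand turns the form into its negative, so its positive and negative
indices coincide; together they make up the rank `2 rank N`. -/
theorem negIndex_fromBlocks_antidiagonal (N : Matrix ι κ ℝ) :
    negIndex (fromBlocks (0 : Matrix ι ι ℝ) N Nᵀ 0) = N.rank := by
  have hs : (fromBlocks (0 : Matrix ι ι ℝ) N Nᵀ (0 : Matrix κ κ ℝ)).IsSymm :=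
    isSymm_fromBlocks_transpose (by simp [Matrix.IsSymm]) (by simp [Matrix.IsSymm])
  let T : Matrix (ι ⊕ κ) (ι ⊕ κ) ℝ := fromBlocks 1 0 0 (-1)
  have hT : T * T = 1 := by simp [T, fromBlocks_multiply]
  have h1 : Tᵀ * fromBlocks (0 : Matrix ι ι ℝ) N Nᵀ 0 * T = - fromBlocks 0 N Nᵀ 0 := by
    simp [T, fromBlocks_multiply, fromBlocks_transpose, fromBlocks_neg]
  have h2 := negIndex_add_negIndex_neg hs
  rw [← h1, negIndex_congr_of_mul_eq_one hT, rank_fromBlocks_antidiagonal] at h2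
  omega

/-- Generalized Schur complement with vanishing pivot block. -/
theorem negIndex_fromBlocks_zero {N : Matrix ι κ ℝ} {N' : Matrix κ ι ℝ} {C : Matrix κ κ ℝ}
    (hC : C.IsSymm) (h1 : N * N' * N = N) (h2 : (N' * N)ᵀ = N' * N) :
    negIndex (fromBlocks 0 N Nᵀ C) =
      N.rank + negIndex ((1 - N' * N) * C * (1 - N' * N)) := by
  set E := N' * N with hE
  have hEN : Nᵀ * N'ᵀ = E := by rw [← transpose_mul, ← hE, h2]
  have hNE : N * E = N := by rw [hE, ← Matrix.mul_assoc, h1]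
  have hEE : E * E = E := by
    conv_lhs => lhs; rw [hE]
    rw [Matrix.mul_assoc, hNE]
  have hVs : ((1 - E) * C * (1 - E)).IsSymm := by
    simp [Matrix.IsSymm, transpose_sub, h2, hC.eq, Matrix.mul_assoc]
  have h0 : (0 : Matrix ι ι ℝ).IsSymm := by simp [Matrix.IsSymm]
  have h0' : (0 : Matrix κ κ ℝ).IsSymm := by simp [Matrix.IsSymm]
  -- The shear by `K` subtracts `E C + C E - E C E` from `C`. The factor `1 / 2` divides the term `E
  -- C E` evenly between `Kᵀ N` and `Nᵀ K`.
  let K : Matrix ι κ ℝ := -(N'ᵀ * (C - (1 / 2 : ℝ) • (C * E)))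
  have hNK : Nᵀ * K = -(E * C - (1 / 2 : ℝ) • (E * C * E)) := by
    simp only [K]
    rw [Matrix.mul_neg, ← Matrix.mul_assoc, hEN, Matrix.mul_sub, Matrix.mul_smul,
      ← Matrix.mul_assoc E C E]
  have hKN : Kᵀ * N = -(C * E - (1 / 2 : ℝ) • (E * C * E)) := by
    have := congrArg transpose hNK
    rw [transpose_mul, transpose_transpose] at this
    rw [this]
    simp [transpose_sub, h2, hC.eq, Matrix.mul_assoc]
  let T : Matrix (ι ⊕ κ) (ι ⊕ κ) ℝ := fromBlocks 1 K 0 1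
  have hT : T * fromBlocks 1 (-K) 0 1 = 1 := by simp [T, fromBlocks_multiply]
  have hc : Tᵀ * fromBlocks 0 N Nᵀ C * T =
      fromBlocks 0 0 0 ((1 - E) * C * (1 - E)) + fromBlocks 0 N Nᵀ 0 := by
    have : Kᵀ * N + (Nᵀ * K + C) = (1 - E) * C * (1 - E) := by
      rw [hKN, hNK]
      simp only [Matrix.mul_sub, Matrix.sub_mul, Matrix.mul_one, Matrix.one_mul]
      module
    simp [T, fromBlocks_multiply, fromBlocks_transpose, fromBlocks_add, ← this]
    abel
  have hNV : N * (1 - E) = 0 := by rw [Matrix.mul_sub, Matrix.mul_one, hNE, sub_self]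
  have hVN : (1 - E) * Nᵀ = 0 := by
    have := congrArg transpose hNV
    rwa [transpose_mul, transpose_sub, h2, transpose_one, transpose_zero] at this
  rw [← negIndex_congr_of_mul_eq_one hT, hc, negIndex_add_of_mul_eq_zero,
    negIndex_fromBlocks_diagonal h0 hVs, negIndex_zero, negIndex_fromBlocks_antidiagonal]
  · ring
  · rw [Matrix.isSymm_fromBlocks_iff]
    exact ⟨h0, by simp, by simp, hVs⟩
  · exact isSymm_fromBlocks_transpose h0 h0'
  · simp [fromBlocks_multiply, Matrix.mul_assoc, hVN]

/-- Additivity of inertia with respect to the generalized Schur complement. -/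
theorem negIndex_fromBlocks {A A' : Matrix ι ι ℝ} {B : Matrix ι κ ℝ} {C : Matrix κ κ ℝ}
    {N' : Matrix κ ι ℝ} (hA : A.IsSymm) (hC : C.IsSymm)
    (hA' : A'.IsSymm) (hAA : A * A' * A = A) (hAA' : A' * A * A' = A')
    (hcomm : A * A' = A' * A)
    (h1 : (1 - A' * A) * B * N' * ((1 - A' * A) * B) = (1 - A' * A) * B)
    (h2 : (N' * ((1 - A' * A) * B))ᵀ = N' * ((1 - A' * A) * B)) :
    negIndex (fromBlocks A B Bᵀ C) =
      negIndex A + (((1 - A' * A) * B).rank +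
        negIndex ((1 - N' * ((1 - A' * A) * B)) * (C - Bᵀ * A' * B) *
          (1 - N' * ((1 - A' * A) * B)))) := by
  set M := (1 - A' * A) * B with hM
  have hMt : Mᵀ = Bᵀ * (1 - A' * A) := by
    rw [hM, transpose_mul, transpose_sub, transpose_one, transpose_mul, hA.eq, hA'.eq, hcomm]
  have hAM : A * M = 0 := by
    rw [hM, ← Matrix.mul_assoc, Matrix.mul_sub, Matrix.mul_one, ← Matrix.mul_assoc, hAA, sub_self,
      Matrix.zero_mul]
  have hCs : (C - Bᵀ * A' * B).IsSymm := by
    simp [Matrix.IsSymm, transpose_sub, hC.eq, hA'.eq, Matrix.mul_assoc]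
  have h0 : (0 : Matrix ι ι ℝ).IsSymm := by simp [Matrix.IsSymm]
  have h0' : (0 : Matrix κ κ ℝ).IsSymm := by simp [Matrix.IsSymm]
  -- Completing the square with the pseudoinverse removes only the part of `B` in the range of `A`.
  -- The remainder `M` satisfies `A M = 0`, so the two resulting summands have product zero and
  -- their indices add.
  let T : Matrix (ι ⊕ κ) (ι ⊕ κ) ℝ := fromBlocks 1 (-(A' * B)) 0 1
  have hT : T * fromBlocks 1 (A' * B) 0 1 = 1 := by simp [T, fromBlocks_multiply]
  have hc : Tᵀ * fromBlocks A B Bᵀ C * T =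
      fromBlocks A 0 0 0 + fromBlocks 0 M Mᵀ (C - Bᵀ * A' * B) := by
    have e1 : -(A * (A' * B)) + B = M := by
      rw [hM, ← Matrix.mul_assoc, hcomm, Matrix.sub_mul, Matrix.one_mul]; abel
    have e2 : -(Bᵀ * A' * A) + Bᵀ = Mᵀ := by
      rw [hMt, Matrix.mul_sub, Matrix.mul_one, Matrix.mul_assoc]; abel
    have e3 : Mᵀ * (A' * B) = 0 := by
      rw [hMt, Matrix.mul_assoc, ← Matrix.mul_assoc _ A', Matrix.sub_mul, Matrix.one_mul, hAA',
        sub_self, Matrix.zero_mul, Matrix.mul_zero]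
    have hTt : Tᵀ = fromBlocks 1 0 (-(Bᵀ * A')) 1 := by
      simp [T, fromBlocks_transpose, hA'.eq]
    rw [hTt, fromBlocks_multiply]
    simp only [Matrix.one_mul, Matrix.zero_mul, add_zero, Matrix.neg_mul, e2]
    simp only [T, fromBlocks_multiply, fromBlocks_add, Matrix.mul_one, Matrix.mul_zero, add_zero,
      Matrix.mul_neg, e1, e3, zero_add, neg_zero]
    congr 1
    abel
  rw [← negIndex_congr_of_mul_eq_one hT, hc, negIndex_add_of_mul_eq_zero,
    negIndex_fromBlocks_diagonal hA h0', negIndex_zero, negIndex_fromBlocks_zero hCs h1 h2, add_zero]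
  · rw [Matrix.isSymm_fromBlocks_iff]
    exact ⟨hA, by simp, by simp, h0'⟩
  · exact isSymm_fromBlocks_transpose h0 hCs
  · simp [fromBlocks_multiply, hAM]

/-- The negative index is lower semicontinuous. -/
theorem eventually_negIndex_le (P : Matrix ι ι ℝ) :
    ∀ᶠ Q in nhds P, negIndex P ≤ negIndex Q := by
  obtain ⟨N, hN, hneg⟩ := exists_finrank_eq_sigNeg_and_negDef P.toQuadraticForm'
  -- On the compact unit sphere of a maximal negative definite subspace of `P`, strict negativity
  -- persists for all nearby matrices.
  let K : Set (ι → ℝ) := Metric.sphere 0 1 ∩ N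
  have hK : IsCompact K := (isCompact_sphere 0 1).inter_right N.closed_of_finiteDimensional
  have hev : ∀ᶠ Q in nhds P, ∀ x ∈ K, x ⬝ᵥ Q *ᵥ x < 0 := by
    refine hK.eventually_forall_of_forall_eventually fun x hx => ?_
    have hx0 : x ⬝ᵥ P *ᵥ x < 0 := by
      have h := hneg ⟨x, hx.2⟩ (by
        intro h
        have h0 : x = 0 := congrArg Subtype.val h
        have := hx.1
        simp [h0] at this)
      rw [QuadraticMap.restrict_apply, _root_.neg_apply, toQuadraticForm'_eq] at h
      linarith
    have h2 : Continuous fun z : Matrix ι ι ℝ × (ι → ℝ) => z.2 ⬝ᵥ z.1 *ᵥ z.2 := by fun_prop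
    exact (h2.tendsto (P, x)).eventually_lt_const hx0
  filter_upwards [hev] with t ht
  rw [negIndex, ← hN]
  refine le_sigNeg_of_negDef _ fun x hx => ?_
  rw [QuadraticMap.restrict_apply, _root_.neg_apply, toQuadraticForm'_eq]
  have hx' : (x : ι → ℝ) ≠ 0 := by simpa using hx
  have hnx : ‖(x : ι → ℝ)‖ ≠ 0 := by simpa using hx'
  have h := ht (‖(x : ι → ℝ)‖⁻¹ • (x : ι → ℝ)) ⟨by simp [norm_smul, hnx], N.smul_mem _ x.2⟩
  rw [mulVec_smul, dotProduct_smul, smul_dotProduct, smul_smul, smul_eq_mul] at h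
  have : 0 < ‖(x : ι → ℝ)‖⁻¹ * ‖(x : ι → ℝ)‖⁻¹ := by positivity
  nlinarith

/-- Along a continuous family of symmetric matrices of constant rank the inertia is constant. -/
theorem eventually_negIndex_eq {X : Type*} [TopologicalSpace X] {s : Set X} {t₀ : X}
    {P : X → Matrix ι ι ℝ} (hP : ContinuousWithinAt P s t₀) (h0 : (P t₀).IsSymm)
    (hs : ∀ᶠ t in nhdsWithin t₀ s, (P t).IsSymm)
    (hr : ∀ᶠ t in nhdsWithin t₀ s, (P t).rank = (P t₀).rank) :
    ∀ᶠ t in nhdsWithin t₀ s, negIndex (P t) = negIndex (P t₀) ∧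
      negIndex (-P t) = negIndex (-P t₀) := by
  -- Neither the negative nor the positive index can drop, and their sum is the constant rank, so
  -- neither can grow.
  filter_upwards [hP.eventually (eventually_negIndex_le _), hP.neg.eventually (eventually_negIndex_le _), hs, hr]
    with t h1 h2 h3 h4
  rw [← negIndex_add_negIndex_neg h3, ← negIndex_add_negIndex_neg h0] at h4
  simp only [Pi.neg_apply] at h2
  omega

end Inertia

/-! ### Pseudoinverses of symmetric matrices. -/

section Pinv
variable {n : ℕ}

theorem pinv_isSymm {A : Matrix (Fin n) (Fin n) ℝ} (hA : A.IsSymm) : (pinv A).IsSymm := by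
  have h := pinv_spec A
  refine IsPenroseInverse.unique (A := A) ⟨?_, ?_, ?_, ?_⟩ h
  · have := congrArg transpose h.mul_mul_left
    simpa [hA.eq, Matrix.mul_assoc] using this
  · have := congrArg transpose h.mul_mul_right
    simpa [hA.eq, Matrix.mul_assoc] using this
  · have := h.symm_right
    rw [transpose_mul, hA.eq] at this
    rw [this, transpose_mul, hA.eq, this]
  · have := h.symm_left
    rw [transpose_mul, hA.eq] at this
    rw [this, transpose_mul, hA.eq, this]

theorem mul_pinv_comm {A : Matrix (Fin n) (Fin n) ℝ} (hA : A.IsSymm) :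
    A * pinv A = pinv A * A := by
  have h := (pinv_spec A).symm_right
  rw [← h, transpose_mul, hA.eq, (pinv_isSymm hA).eq]

/-- `A†A` depends only on the kernel of `A`. -/
theorem pinv_mul_self_eq {A B C D : Matrix (Fin n) (Fin n) ℝ} (h1 : C * A = B) (h2 : D * B = A) :
    pinv A * A = pinv B * B := by
  have hA := pinv_spec A
  have hB := pinv_spec B
  have e1 : (pinv B * B) * (pinv A * A) = pinv B * B := by
    have : B * (pinv A * A) = B := by
      rw [← h1, Matrix.mul_assoc, ← Matrix.mul_assoc A, hA.mul_mul_left]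
    rw [Matrix.mul_assoc, this]
  have e2 : (pinv A * A) * (pinv B * B) = pinv A * A := by
    have : A * (pinv B * B) = A := by
      rw [← h2, Matrix.mul_assoc, ← Matrix.mul_assoc B, hB.mul_mul_left]
    rw [Matrix.mul_assoc, this]
  have e3 := congrArg transpose e2
  rw [transpose_mul, hA.symm_right, hB.symm_right] at e3
  rw [← e3, e1]

end Pinv

/-! ### Symmetric charts of Lagrangian planes. -/

variable {n : ℕ}

/-- The lower block `U` of `Y = (Xᵀ Uᵀ)ᵀ`. -/
def lower (Y : Tall n) : Matrix (Fin n) (Fin n) ℝ := Y.toRows₂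

theorem fromRows_upper_lower (Y : Tall n) : fromRows (upper Y) (lower Y) = Y := by
  simp [upper, lower]

/-- `U - s X`. -/
def shear (s : ℝ) (Y : Tall n) : Matrix (Fin n) (Fin n) ℝ := lower Y - s • upper Y

/-- The matrix `X (U - s X)⁻¹` representing the plane of `Y` as a graph over the vertical plane
along the plane of `(I  sI)ᵀ`. -/
def chart (s : ℝ) (Y : Tall n) : Matrix (Fin n) (Fin n) ℝ := upper Y * (shear s Y)⁻¹

theorem wronskian_eq (Y Yh : Tall n) :
    wronskian Y Yh = (upper Y)ᵀ * lower Yh - (lower Y)ᵀ * upper Yh := by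
  conv_lhs => rw [← fromRows_upper_lower Y, ← fromRows_upper_lower Yh]
  rw [wronskian, calJ, transpose_fromRows, fromCols_mul_fromBlocks, fromCols_mul_fromRows]
  simp
  abel

/-- Replacing `U` by `U - s X` is a symplectic change of coordinates: the two terms with `s` cancel.
-/
theorem wronskian_eq_shear (s : ℝ) (Y Yh : Tall n) :
    wronskian Y Yh = (upper Y)ᵀ * shear s Yh - (shear s Y)ᵀ * upper Yh := by
  rw [wronskian_eq, shear, shear]
  simp [Matrix.mul_sub, Matrix.sub_mul]

theorem IsLagrangian.upper_transpose_mul_shear {Y : Tall n} (hY : IsLagrangian Y) (s : ℝ) :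
    (upper Y)ᵀ * shear s Y = (shear s Y)ᵀ * upper Y := by
  have h := hY.1
  change wronskian Y Y = 0 at h
  rwa [wronskian_eq_shear s, sub_eq_zero] at h

theorem chart_mul_shear {s : ℝ} {Y : Tall n} (hD : IsUnit (shear s Y).det) :
    chart s Y * shear s Y = upper Y := by
  rw [chart, Matrix.mul_assoc, nonsing_inv_mul _ hD, Matrix.mul_one]

theorem shear_transpose_mul_chart {s : ℝ} {Y : Tall n} (hY : IsLagrangian Y)
    (hD : IsUnit (shear s Y).det) : (shear s Y)ᵀ * chart s Y = (upper Y)ᵀ := by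
  rw [chart, ← Matrix.mul_assoc, ← hY.upper_transpose_mul_shear, Matrix.mul_assoc,
    mul_nonsing_inv _ hD, Matrix.mul_one]

theorem chart_isSymm {s : ℝ} {Y : Tall n} (hY : IsLagrangian Y)
    (hD : IsUnit (shear s Y).det) : (chart s Y).IsSymm := by
  have h := shear_transpose_mul_chart hY hD
  have h2 := congrArg transpose (chart_mul_shear hD)
  rw [transpose_mul, ← h] at h2
  have hu : IsUnit (shear s Y)ᵀ := (isUnit_iff_isUnit_det _).2 (by rwa [det_transpose])
  exact hu.mul_left_cancel h2

theorem wronskian_eq_chart {s : ℝ} {Y Yh : Tall n} (hY : IsLagrangian Y)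
    (hD : IsUnit (shear s Y).det) (hDh : IsUnit (shear s Yh).det) :
    wronskian Y Yh = (shear s Y)ᵀ * (chart s Y - chart s Yh) * shear s Yh := by
  rw [wronskian_eq_shear s, Matrix.mul_sub, Matrix.sub_mul, shear_transpose_mul_chart hY hD,
    Matrix.mul_assoc, chart_mul_shear hDh]

theorem rank_chart {s : ℝ} {Y : Tall n} (hD : IsUnit (shear s Y).det) :
    (chart s Y).rank = (upper Y).rank := by
  rw [← chart_mul_shear hD, rank_mul_eq_left_of_isUnit_det _ _ hD]

theorem rank_chart_sub {s : ℝ} {Y Yh : Tall n} (hY : IsLagrangian Y)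
    (hD : IsUnit (shear s Y).det) (hDh : IsUnit (shear s Yh).det) :
    (chart s Y - chart s Yh).rank = (wronskian Y Yh).rank := by
  rw [wronskian_eq_chart hY hD hDh, rank_mul_eq_left_of_isUnit_det _ _ hDh,
    rank_mul_eq_right_of_isUnit_det _ _ (by rwa [det_transpose])]

/-! ### The comparative index in terms of inertia. -/

section CompIndex
variable (Y Yh : Tall n)

theorem calM_mul_calV : calM Y Yh * calV Y Yh = 0 := by
  rw [calV, Matrix.mul_sub, Matrix.mul_one, ← Matrix.mul_assoc, (pinv_spec _).mul_mul_left,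
    sub_self]

theorem calV_isSymm : (calV Y Yh).IsSymm := by
  rw [Matrix.IsSymm, calV, transpose_sub, transpose_one, (pinv_spec _).symm_right]

/-- `W V = X†X W V`. -/
theorem wronskian_mul_calV :
    wronskian Y Yh * calV Y Yh = pinv (upper Y) * upper Y * (wronskian Y Yh * calV Y Yh) := by
  have h := calM_mul_calV Y Yh
  rw [calM, Matrix.mul_assoc, Matrix.sub_mul, Matrix.one_mul, sub_eq_zero] at h
  exact h

theorem calV_mul_wronskian_transpose :
    calV Y Yh * (wronskian Y Yh)ᵀ =
      calV Y Yh * (wronskian Y Yh)ᵀ * (pinv (upper Y) * upper Y) := by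
  have h := congrArg transpose (wronskian_mul_calV Y Yh)
  rwa [transpose_mul _ (_ * calV Y Yh), transpose_mul, (pinv_spec _).symm_right,
    (calV_isSymm Y Yh).eq] at h

variable {Y Yh}

/-- The columns of `X̂ V` lie in the range of `X`. -/
theorem upper_mul_pinv_mul_calV {s : ℝ} (hY : IsLagrangian Y) (hD : IsUnit (shear s Y).det) :
    upper Y * pinv (upper Y) * (upper Yh * calV Y Yh) = upper Yh * calV Y Yh := by
  set X := upper Y
  set Xh := upper Yh
  set V := calV Y Yh
  set W := wronskian Y Yh with hW
  have hX := pinv_spec X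
  -- `W = Xᵀ D̂ - Dᵀ X̂`, and `W V` lies in the range of `Xᵀ` by `wronskian_mul_calV`; hence so does
  -- `Dᵀ X̂ V`. As `Xᵀ = Dᵀ X D⁻¹`, the factor `Dᵀ` cancels.
  obtain ⟨T, hT⟩ : ∃ T, (shear s Y)ᵀ * (Xh * V) = Xᵀ * T := by
    refine ⟨shear s Yh * V - (pinv X)ᵀ * (W * V), ?_⟩
    rw [Matrix.mul_sub, ← Matrix.mul_assoc _ (pinv X)ᵀ, ← transpose_mul, hX.symm_right,
      ← wronskian_mul_calV, ← hW, hW, wronskian_eq_shear s, Matrix.sub_mul]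
    simp only [Matrix.mul_assoc]
    abel
  have hu : IsUnit (shear s Y)ᵀ := (isUnit_iff_isUnit_det _).2 (by rwa [det_transpose])
  have h : Xh * V = X * ((shear s Y)⁻¹ * T) := by
    rw [← shear_transpose_mul_chart hY hD, Matrix.mul_assoc] at hT
    rw [hu.mul_left_cancel hT, chart, Matrix.mul_assoc]
  rw [h, ← Matrix.mul_assoc, hX.mul_mul_left]

/-- Exhibits `𝒫` as the compression by `V` of a Schur complement. Because `V Wᵀ = V Wᵀ X†X`, the
factors to its right matter only after multiplication by `X`, and there the two sides differ by the
relation `W = Xᵀ D̂ - Dᵀ X̂`. -/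
theorem calP_eq {s : ℝ} (hY : IsLagrangian Y) (hD : IsUnit (shear s Y).det) :
    calP Y Yh = calV Y Yh * ((wronskian Y Yh)ᵀ * ((shear s Y)⁻¹ * shear s Yh) -
      (wronskian Y Yh)ᵀ * pinv ((shear s Y)ᵀ * upper Y) * wronskian Y Yh) * calV Y Yh := by
  have hR := upper_mul_pinv_mul_calV (Yh := Yh) hY hD
  have hWV := wronskian_mul_calV Y Yh
  have hVW := calV_mul_wronskian_transpose Y Yh
  have hWs := wronskian_eq_shear s Y Yh
  have hAs : ((shear s Y)ᵀ * upper Y).IsSymm := by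
    rw [Matrix.IsSymm, transpose_mul, transpose_transpose, hY.upper_transpose_mul_shear]
  have hu : IsUnit (shear s Y)ᵀ := (isUnit_iff_isUnit_det _).2 (by rwa [det_transpose])
  have hproj : pinv (upper Y) * upper Y =
      pinv ((shear s Y)ᵀ * upper Y) * ((shear s Y)ᵀ * upper Y) :=
    pinv_mul_self_eq (C := (shear s Y)ᵀ) (D := ((shear s Y)ᵀ)⁻¹) rfl (by
      rw [← Matrix.mul_assoc, nonsing_inv_mul _ (by rwa [det_transpose]), Matrix.one_mul])
  have hcomm := mul_pinv_comm hAs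
  have hXD := shear_transpose_mul_chart hY hD
  rw [chart, ← Matrix.mul_assoc] at hXD
  rw [calP]
  set X := upper Y
  set Xh := upper Yh
  set V := calV Y Yh
  set W := wronskian Y Yh
  set D := shear s Y
  set Dh := shear s Yh
  have key : X * ((D⁻¹ * Dh - pinv (Dᵀ * X) * W - pinv X * Xh) * V) = 0 := by
    refine hu.mul_left_cancel ?_
    have e1 : Dᵀ * (X * (D⁻¹ * Dh * V)) = Xᵀ * Dh * V := by
      rw [← hXD]; simp only [Matrix.mul_assoc]
    have e2 : Dᵀ * (X * (pinv (Dᵀ * X) * W * V)) = W * V := by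
      rw [← Matrix.mul_assoc, Matrix.mul_assoc _ W, ← Matrix.mul_assoc, hcomm, ← hproj, ← hWV]
    have e3 : Dᵀ * (X * (pinv X * Xh * V)) = Dᵀ * Xh * V := by
      rw [Matrix.mul_assoc _ Xh, ← Matrix.mul_assoc X, hR, Matrix.mul_assoc]
    rw [Matrix.mul_zero, Matrix.sub_mul, Matrix.sub_mul, Matrix.mul_sub, Matrix.mul_sub,
      Matrix.mul_sub, Matrix.mul_sub, e1, e2, e3, hWs, Matrix.sub_mul]
    abel
  have key2 : V * Wᵀ * ((D⁻¹ * Dh - pinv (Dᵀ * X) * W - pinv X * Xh) * V) = 0 := by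
    rw [hVW, Matrix.mul_assoc, Matrix.mul_assoc (pinv X), key, Matrix.mul_zero, Matrix.mul_zero]
  rw [Matrix.sub_mul, Matrix.sub_mul, Matrix.mul_sub, Matrix.mul_sub, sub_eq_zero] at key2
  rw [Matrix.mul_sub, Matrix.sub_mul]
  simp only [Matrix.mul_assoc] at key2 ⊢
  exact key2.symm

/-- The comparative index in terms of the inertia of the chart matrices. -/
theorem negIndex_chart_add_compIndex {s : ℝ} (hY : IsLagrangian Y) (hYh : IsLagrangian Yh)
    (hD : IsUnit (shear s Y).det) (hDh : IsUnit (shear s Yh).det) {ε : ℝ} (hε : ε * ε = 1) :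
    negIndex (ε • chart s Y) + ((calM Y Yh).rank + ind (ε • calP Y Yh)) =
      negIndex (ε • chart s Yh) + negIndex (ε • (chart s Y - chart s Yh)) := by
  have hAs := chart_isSymm hY hD
  have hBs := chart_isSymm hYh hDh
  have hW := wronskian_eq_chart hY hD hDh
  have hP := calP_eq (Yh := Yh) hY hD
  have hAD := chart_mul_shear hD
  have hproj : pinv (upper Y) * upper Y =
      pinv ((shear s Y)ᵀ * upper Y) * ((shear s Y)ᵀ * upper Y) :=
    pinv_mul_self_eq (C := (shear s Y)ᵀ) (D := ((shear s Y)ᵀ)⁻¹) rfl (by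
      rw [← Matrix.mul_assoc, nonsing_inv_mul _ (by rwa [det_transpose]), Matrix.one_mul])
  have hcA : (shear s Y)ᵀ * upper Y = (shear s Y)ᵀ * chart s Y * shear s Y := by
    rw [Matrix.mul_assoc, hAD]
  rw [hcA] at hP hproj
  have hM : calM Y Yh = (1 - pinv ((shear s Y)ᵀ * chart s Y * shear s Y) *
      ((shear s Y)ᵀ * chart s Y * shear s Y)) * wronskian Y Yh := by
    rw [calM, hproj]
  have hC : (wronskian Y Yh)ᵀ * ((shear s Y)⁻¹ * shear s Yh) =
      (shear s Yh)ᵀ * (chart s Y - chart s Yh) * shear s Yh := by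
    rw [hW]
    simp only [transpose_mul, transpose_transpose, transpose_sub, hAs.eq, hBs.eq]
    simp only [Matrix.mul_assoc]
    rw [← Matrix.mul_assoc (shear s Y), mul_nonsing_inv _ hD, Matrix.one_mul]
  rw [hC] at hP
  have hV : calV Y Yh = 1 - pinv (calM Y Yh) * calM Y Yh := rfl
  set A := chart s Y
  set B := chart s Yh
  set D := shear s Y
  set Dh := shear s Yh
  set W := wronskian Y Yh
  set M := calM Y Yh
  set cA := Dᵀ * A * D
  have hcAs : cA.IsSymm := by simp [cA, Matrix.IsSymm, hAs.eq, Matrix.mul_assoc]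
  have hcCs : (Dhᵀ * (A - B) * Dh).IsSymm := by
    simp [Matrix.IsSymm, hAs.eq, hBs.eq, Matrix.mul_assoc, transpose_sub]
  have hp := pinv_spec cA
  have hm := pinv_spec M
  -- As `ε` is its own inverse, `ε • A†` acts as the pseudoinverse of `ε • A`.
  have hsm : ∀ K L : Matrix (Fin n) (Fin n) ℝ, (ε • K) * (ε • L) = K * L := by
    intro K L
    rw [Matrix.smul_mul, Matrix.mul_smul, smul_smul, hε, one_smul]
  have hPs : (ε • calP Y Yh).IsSymm := by
    have h1 := (calV_isSymm Y Yh).eq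
    have h2 := (pinv_isSymm hcAs).eq
    have h3 := hcCs.eq
    rw [hP]
    refine IsSymm.smul ?_ _
    rw [Matrix.IsSymm, transpose_mul, transpose_mul, h1, transpose_sub, h3]
    simp [h2, Matrix.mul_assoc]
  have e1 : (1 - (ε • pinv cA) * (ε • cA)) * (ε • W) = ε • M := by
    rw [hsm, Matrix.mul_smul, ← hM]
  have schur := negIndex_fromBlocks (A := ε • cA) (A' := ε • pinv cA) (B := ε • W)
    (C := ε • (Dhᵀ * (A - B) * Dh)) (N' := ε • pinv M) (hcAs.smul _) (hcCs.smul _)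
    ((pinv_isSymm hcAs).smul _) (by rw [hsm, Matrix.mul_smul, hp.mul_mul_left])
    (by rw [hsm, Matrix.mul_smul, hp.mul_mul_right]) (by rw [hsm, hsm, mul_pinv_comm hcAs])
    (by rw [e1, hsm, Matrix.mul_smul, hm.mul_mul_left])
    (by rw [e1, hsm, hm.symm_right])
  have e2 : ε • (Dhᵀ * (A - B) * Dh) - (ε • W)ᵀ * (ε • pinv cA) * (ε • W) =
      ε • (Dhᵀ * (A - B) * Dh - Wᵀ * pinv cA * W) := by
    rw [transpose_smul, hsm, Matrix.mul_smul, smul_sub]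
  have e3 : (ε • M).rank = M.rank := by
    have : IsUnit (ε • (1 : Matrix (Fin n) (Fin n) ℝ)).det :=
      isUnit_det_of_right_inverse (B := ε • 1) (by rw [hsm, Matrix.one_mul])
    rw [← Matrix.mul_one M, ← Matrix.mul_smul, rank_mul_eq_left_of_isUnit_det _ _ this,
      Matrix.mul_one]
  rw [e1, hsm, e2, e3, ← hV, Matrix.mul_smul, Matrix.smul_mul, ← hP,
    ← ind_eq_negIndex hPs] at schur
  have e4 : negIndex (ε • cA) = negIndex (ε • A) := by
    rw [← negIndex_congr hD (ε • A), Matrix.mul_smul, Matrix.smul_mul]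
  rw [← e4, ← schur, ← negIndex_fromBlocks_diagonal (hBs.smul ε) ((hAs.sub hBs).smul ε)]
  -- Second evaluation of the same block matrix: it is `Tᵀ diag(εB, ε(A - B)) T`.
  let T : Big n := fromBlocks D 0 D Dh
  have hT : IsUnit T.det := by
    rw [det_fromBlocks_zero₁₂]; exact hD.mul hDh
  rw [← negIndex_congr hT (fromBlocks (ε • B) 0 0 (ε • (A - B)))]
  congr 1
  simp only [T, fromBlocks_transpose, fromBlocks_multiply]
  simp only [Matrix.mul_zero, Matrix.zero_mul, add_zero, zero_add, transpose_zero, Matrix.mul_smul,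
    Matrix.smul_mul]
  congr 1
  · rw [← smul_add, ← Matrix.add_mul, ← Matrix.mul_add, add_sub_cancel]
  · rw [hW]
  · rw [hW]
    simp [hAs.eq, hBs.eq, Matrix.mul_assoc, transpose_sub]

end CompIndex

/-! ### Symplectic invariance, transversality and continuity of charts. -/

theorem symplectic_transpose_mul_calJ_mul {R : Big n} (hR : R ∈ symplecticGroup (Fin n) ℝ) :
    Rᵀ * calJ n * R = calJ n := by
  have h := SymplecticGroup.mem_iff'.1 hR
  have hJ : calJ n = -J (Fin n) ℝ := by simp [calJ, J, fromBlocks_neg]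
  rw [hJ, Matrix.mul_neg, Matrix.neg_mul, h]

theorem symplectic_isUnit {R : Big n} (hR : R ∈ symplecticGroup (Fin n) ℝ) : IsUnit R.det :=
  SymplecticGroup.symplectic_det hR

theorem wronskian_symplectic_mul {R : Big n} (hR : R ∈ symplecticGroup (Fin n) ℝ) (Y Yh : Tall n) :
    wronskian (R * Y) (R * Yh) = wronskian Y Yh := by
  rw [wronskian, wronskian, transpose_mul]
  conv_rhs => rw [← symplectic_transpose_mul_calJ_mul hR]
  simp only [Matrix.mul_assoc]

theorem IsLagrangian.symplectic_mul {R : Big n} (hR : R ∈ symplecticGroup (Fin n) ℝ) {Y : Tall n}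
    (hY : IsLagrangian Y) : IsLagrangian (R * Y) := by
  refine ⟨?_, ?_⟩
  · exact (wronskian_symplectic_mul hR Y Y).trans hY.1
  · rw [rank_mul_eq_right_of_isUnit_det _ _ (symplectic_isUnit hR), hY.2]

theorem isLagrangian_vertE : IsLagrangian (vertE n) := by
  refine ⟨?_, ?_⟩
  · change wronskian (vertE n) (vertE n) = 0
    rw [wronskian_eq]
    simp [upper, lower, vertE]
  · rw [← rank_transpose_mul_self]
    simp [vertE, transpose_fromRows, fromCols_mul_fromRows]

theorem inv_symplectic {R : Big n} (hR : R ∈ symplecticGroup (Fin n) ℝ) :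
    R⁻¹ ∈ symplecticGroup (Fin n) ℝ := by
  have := (⟨R, hR⟩ : symplecticGroup (Fin n) ℝ)⁻¹.2
  rwa [SymplecticGroup.coe_inv'] at this

/-- The rank of the upper block of `R⁻¹ Y` is that of the Wronskian of `Y` and `R E`. -/
theorem rank_upper_inv_mul {R : Big n} (hR : R ∈ symplecticGroup (Fin n) ℝ) (Y : Tall n) :
    (upper (R⁻¹ * Y)).rank = (wronskian Y (R * vertE n)).rank := by
  have h := wronskian_symplectic_mul hR (R⁻¹ * Y) (vertE n)
  rw [← Matrix.mul_assoc, mul_nonsing_inv _ (symplectic_isUnit hR), Matrix.one_mul] at h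
  rw [h, wronskian_eq]
  simp [upper, lower, vertE, rank_transpose]

theorem IsLagrangian.mulVec_injective {Y : Tall n} (hY : IsLagrangian Y) :
    Function.Injective (Y *ᵥ ·) := by
  have h := LinearMap.finrank_range_add_finrank_ker Y.mulVecLin
  have h2 : Module.finrank ℝ (LinearMap.range Y.mulVecLin) = n := hY.2
  rw [h2] at h
  have h3 : Module.finrank ℝ (LinearMap.ker Y.mulVecLin) = 0 := by simpa using h
  exact LinearMap.ker_eq_bot.1 (Submodule.finrank_eq_zero.1 h3)

/-- A Lagrangian plane is transversal to all but finitely many of the planes of `(I  σI)ᵀ`. -/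
theorem IsLagrangian.eventually_isUnit_shear {Y : Tall n} (hY : IsLagrangian Y) :
    ∀ᶠ σ in cofinite, IsUnit (shear σ Y).det := by
  rw [eventually_cofinite]
  -- Exceptional values `σ` behave like eigenvalues of a self-adjoint relation: kernel vectors
  -- satisfy `U v = σ X v`. Full rank gives `X v ≠ 0`, and the Lagrangian condition makes these
  -- vectors orthogonal for distinct `σ`, so there are finitely many.
  have hex : ∀ σ : {σ : ℝ | ¬ IsUnit (shear σ Y).det}, ∃ v : Fin n → ℝ, v ≠ 0 ∧
      lower Y *ᵥ v = σ.1 • (upper Y *ᵥ v) := by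
    intro σ
    have h : (shear σ.1 Y).det = 0 := by simpa using σ.2
    obtain ⟨v, hv, h⟩ := exists_mulVec_eq_zero_iff.2 h
    refine ⟨v, hv, ?_⟩
    rwa [shear, sub_mulVec, smul_mulVec, sub_eq_zero] at h
  choose v hv hlow using hex
  have hne : ∀ σ, upper Y *ᵥ v σ ≠ 0 := by
    intro σ h
    have h2 := hlow σ
    rw [h, smul_zero] at h2
    refine hv σ (hY.mulVec_injective ?_)
    simp only [mulVec_zero]
    rw [← fromRows_upper_lower Y, fromRows_mulVec, h, h2]
    ext (i | i) <;> simp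
  have hsymm : (upper Y)ᵀ * lower Y = (lower Y)ᵀ * upper Y := by
    have h := hY.1
    change wronskian Y Y = 0 at h
    rwa [wronskian_eq, sub_eq_zero] at h
  have horth : ∀ σ τ, σ ≠ τ → (upper Y *ᵥ v σ) ⬝ᵥ (upper Y *ᵥ v τ) = 0 := by
    intro σ τ hστ
    have h1 : v σ ⬝ᵥ ((upper Y)ᵀ * lower Y) *ᵥ v τ = v σ ⬝ᵥ ((lower Y)ᵀ * upper Y) *ᵥ v τ := by
      rw [hsymm]
    rw [← mulVec_mulVec, ← mulVec_mulVec, dotProduct_mulVec _ (upper Y)ᵀ,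
      dotProduct_mulVec _ (lower Y)ᵀ, vecMul_transpose,
      vecMul_transpose, hlow, hlow, dotProduct_smul, smul_dotProduct, smul_eq_mul, smul_eq_mul] at h1
    have h2 : (τ.1 - σ.1) * ((upper Y *ᵥ v σ) ⬝ᵥ (upper Y *ᵥ v τ)) = 0 := by linarith
    rcases mul_eq_zero.1 h2 with h | h
    · exact absurd (Subtype.ext (sub_eq_zero.1 h).symm) hστ
    · exact h
  have hli : LinearIndependent ℝ fun σ => (WithLp.toLp 2 (upper Y *ᵥ v σ) : EuclideanSpace ℝ (Fin n)) := by
    refine linearIndependent_of_ne_zero_of_inner_eq_zero (fun σ h => hne σ ?_) fun σ τ h => ?_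
    · exact (WithLp.toLp_eq_zero 2).1 h
    · beta_reduce
      rw [EuclideanSpace.inner_toLp_toLp, star_trivial]
      exact horth τ σ h.symm
  have := hli.finite_of_isNoetherian
  exact Set.toFinite _

theorem continuous_upper : Continuous (upper : Tall n → _) :=
  continuous_id.matrix_submatrix Sum.inl id

theorem continuous_shear (σ : ℝ) : Continuous (shear σ : Tall n → _) :=
  (continuous_id.matrix_submatrix Sum.inr id).sub (continuous_upper.const_smul σ)

theorem continuousAt_chart {σ : ℝ} {Y : Tall n} (hD : IsUnit (shear σ Y).det) :
    ContinuousAt (chart σ) Y := by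
  refine continuous_upper.continuousAt.mul ?_
  have h : ContinuousAt Ring.inverse (shear σ Y).det := by
    obtain ⟨u, hu⟩ := hD
    rw [← hu]
    exact NormedRing.inverse_continuousAt u
  exact ContinuousAt.comp (g := Inv.inv) (continuousAt_matrix_inv _ h) (continuous_shear σ).continuousAt

theorem eventually_isUnit_shear {s : Set ℝ} {t₀ σ : ℝ} {Y : ℝ → Tall n}
    (hY : ContinuousWithinAt Y s t₀) (hD : IsUnit (shear σ (Y t₀)).det) :
    ∀ᶠ t in 𝓝[s] t₀, IsUnit (shear σ (Y t)).det := by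
  have h : ContinuousWithinAt (fun t => (shear σ (Y t)).det) s t₀ :=
    (((continuous_shear σ).matrix_det).continuousAt.comp_continuousWithinAt hY)
  simp only [isUnit_iff_ne_zero] at hD ⊢
  exact h.eventually_ne hD

/-! ### Local increments of the comparative index, and gluing. -/

/-- The comparative index (`ε = 1`) and the dual comparative index (`ε = -1`). -/
def signedIndex (ε : ℝ) (Y Yh : Tall n) : ℕ := (calM Y Yh).rank + ind (ε • calP Y Yh)

theorem compIndex_eq (Y Yh : Tall n) : compIndex Y Yh = signedIndex 1 Y Yh := by
  rw [signedIndex, one_smul]; rfl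

theorem dualCompIndex_eq (Y Yh : Tall n) : dualCompIndex Y Yh = signedIndex (-1) Y Yh := by
  rw [signedIndex, neg_one_smul]; rfl

theorem rank_smul_of_ne_zero {ε : ℝ} (hε : ε ≠ 0) (A : Matrix (Fin n) (Fin n) ℝ) :
    (ε • A).rank = A.rank :=
  rank_smul_of_mem_nonZeroDivisors A (mem_nonZeroDivisors_of_ne_zero hε)

theorem eventually_negIndex_smul_eq {s : Set ℝ} {t₀ ε : ℝ} {P : ℝ → Matrix (Fin n) (Fin n) ℝ}
    (hε : ε ≠ 0) (hP : ContinuousWithinAt P s t₀) (h0 : (P t₀).IsSymm)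
    (hs : ∀ᶠ t in 𝓝[s] t₀, (P t).IsSymm)
    (hr : ∀ᶠ t in 𝓝[s] t₀, (P t).rank = (P t₀).rank) :
    ∀ᶠ t in 𝓝[s] t₀, negIndex (ε • P t) = negIndex (ε • P t₀) := by
  refine (eventually_negIndex_eq (P := fun t => ε • P t) (hP.const_smul ε) (h0.smul ε)
    (hs.mono fun t ht => ht.smul ε) (hr.mono fun t ht => ?_)).mono fun t ht => ht.1
  rw [rank_smul_of_ne_zero hε, rank_smul_of_ne_zero hε, ht]

/-- `F` has locally the same increments as minus the inertia of the charts of `Y`. -/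
def IsBranch (ε : ℝ) (Y : ℝ → Tall n) (s : Set ℝ) (F : ℝ → ℤ) : Prop :=
  ∀ t₀ ∈ s, ∀ᶠ σ in cofinite, ∀ᶠ t in 𝓝[s] t₀,
    F t + negIndex (ε • chart σ (Y t)) = F t₀ + negIndex (ε • chart σ (Y t₀))

/-- The charts of `Yh` and the differences of charts have constant rank, so their indices are
locally constant and the index identity leaves only the chart of `Y`. -/
theorem isBranch_signedIndex {ε : ℝ} (hε : ε * ε = 1) {s : Set ℝ} {Y Yh : ℝ → Tall n}
    (hYc : ContinuousOn Y s) (hY : ∀ t ∈ s, IsLagrangian (Y t))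
    (hYhc : ContinuousOn Yh s) (hYh : ∀ t ∈ s, IsLagrangian (Yh t))
    (hW : ∃ r, ∀ t ∈ s, (wronskian (Y t) (Yh t)).rank = r)
    (hX : ∃ r, ∀ t ∈ s, (upper (Yh t)).rank = r) :
    IsBranch ε Y s fun t => signedIndex ε (Y t) (Yh t) := by
  obtain ⟨r, hW⟩ := hW
  obtain ⟨q, hX⟩ := hX
  have hε0 : ε ≠ 0 := by rintro rfl; simp at hε
  intro t₀ ht₀
  filter_upwards [(hY t₀ ht₀).eventually_isUnit_shear, (hYh t₀ ht₀).eventually_isUnit_shear]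
    with σ hD hDh
  have hcA : ContinuousWithinAt (fun t => chart σ (Y t)) s t₀ :=
    (continuousAt_chart hD).comp_continuousWithinAt (hYc t₀ ht₀)
  have hcB : ContinuousWithinAt (fun t => chart σ (Yh t)) s t₀ :=
    (continuousAt_chart hDh).comp_continuousWithinAt (hYhc t₀ ht₀)
  have hev := eventually_isUnit_shear (hYc t₀ ht₀) hD
  have hevh := eventually_isUnit_shear (hYhc t₀ ht₀) hDh
  have hmem : ∀ᶠ t in 𝓝[s] t₀, t ∈ s := self_mem_nhdsWithin
  have h1 := eventually_negIndex_smul_eq hε0 hcB (chart_isSymm (hYh t₀ ht₀) hDh)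
    (by filter_upwards [hmem, hevh] with t h h' using chart_isSymm (hYh t h) h')
    (by filter_upwards [hmem, hevh] with t h h'
        rw [rank_chart h', rank_chart hDh, hX t h, hX t₀ ht₀])
  have h2 := eventually_negIndex_smul_eq hε0 (hcA.sub hcB)
    ((chart_isSymm (hY t₀ ht₀) hD).sub (chart_isSymm (hYh t₀ ht₀) hDh))
    (by filter_upwards [hmem, hev, hevh] with t h h' h''
          using (chart_isSymm (hY t h) h').sub (chart_isSymm (hYh t h) h''))
    (by filter_upwards [hmem, hev, hevh] with t h h' h''
        simp only [Pi.sub_apply]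
        rw [rank_chart_sub (hY t h) h' h'', rank_chart_sub (hY t₀ ht₀) hD hDh, hW t h, hW t₀ ht₀])
  filter_upwards [hmem, hev, hevh, h1, h2] with t h h' h'' h1 h2
  have e1 := negIndex_chart_add_compIndex (hY t h) (hYh t h) h' h'' hε
  have e2 := negIndex_chart_add_compIndex (hY t₀ ht₀) (hYh t₀ ht₀) hD hDh hε
  simp only [Pi.sub_apply] at h2
  simp only [signedIndex]
  omega

/-- The inertia of the chart cancels in `F - G`, leaving a locally constant integer function on a
connected set. -/
theorem IsBranch.sub_eq {ε : ℝ} {Y : ℝ → Tall n} {s : Set ℝ} (hs : IsPreconnected s) {F G : ℝ → ℤ}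
    (hF : IsBranch ε Y s F) (hG : IsBranch ε Y s G) {t u : ℝ} (ht : t ∈ s) (hu : u ∈ s) :
    F t - F u = G t - G u := by
  have hc : ContinuousOn (fun t => F t - G t) s := by
    intro t₀ ht₀
    -- Each branch excludes only finitely many `σ`, so a common one exists.
    obtain ⟨σ, h1, h2⟩ := ((hF t₀ ht₀).and (hG t₀ ht₀)).exists
    refine tendsto_const_nhds.congr' ?_
    filter_upwards [h1, h2] with t h1 h2
    omega
  have := hs.constant hc ht hu
  omega

/-- Gluing of functions on the intervals of a partition. -/
def glue {p : ℕ} (τ : Fin (p + 1) → ℝ) (f : Fin p → ℝ → ℤ) (t : ℝ) : ℤ :=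
  ∑ k : Fin p, (f k (max (τ k.castSucc) (min t (τ k.succ))) - f k (τ k.castSucc))

theorem sum_sub_telescope {p : ℕ} (h : Fin (p + 1) → ℤ) :
    ∑ k : Fin p, (h k.succ - h k.castSucc) = h (Fin.last p) - h 0 := by
  rw [Finset.sum_sub_distrib]
  have h1 := Fin.sum_univ_succ h
  have h2 := Fin.sum_univ_castSucc h
  omega

/-- For a single function the clamped increments telescope. -/
theorem glue_const {p : ℕ} {τ : Fin (p + 1) → ℝ} (hτ : StrictMono τ) (g : ℝ → ℤ) {t : ℝ}
    (ht : t ∈ Set.Icc (τ 0) (τ (Fin.last p))) : glue τ (fun _ => g) t = g t - g (τ 0) := by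
  have h : ∀ k : Fin p, g (max (τ k.castSucc) (min t (τ k.succ))) - g (τ k.castSucc) =
      g (min t (τ k.succ)) - g (min t (τ k.castSucc)) := by
    intro k
    have hk : τ k.castSucc < τ k.succ := hτ k.castSucc_lt_succ
    rcases le_total t (τ k.castSucc) with h | h
    · rw [min_eq_left (h.trans hk.le), min_eq_left h, max_eq_left h, sub_self, sub_self]
    · rw [min_eq_right h, max_eq_right (le_min h hk.le)]
  rw [glue, Finset.sum_congr rfl fun k _ => h k, sum_sub_telescope fun i => g (min t (τ i)),
    min_eq_left ht.2, min_eq_right ht.1]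

theorem glue_last {p : ℕ} {τ : Fin (p + 1) → ℝ} (hτ : StrictMono τ) (f : Fin p → ℝ → ℤ) :
    glue τ f (τ (Fin.last p)) = ∑ k : Fin p, (f k (τ k.succ) - f k (τ k.castSucc)) := by
  refine Finset.sum_congr rfl fun k _ => ?_
  rw [min_eq_right (hτ.monotone (Fin.le_last _)), max_eq_right (hτ k.castSucc_lt_succ).le]

theorem glue_first {p : ℕ} {τ : Fin (p + 1) → ℝ} (hτ : StrictMono τ) (f : Fin p → ℝ → ℤ) :
    glue τ f (τ 0) = 0 := by
  refine Finset.sum_eq_zero fun k _ => ?_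
  rw [min_eq_left (hτ.monotone (Fin.zero_le _)), max_eq_left (hτ.monotone (Fin.zero_le _)), sub_self]

theorem IsBranch.glue {ε : ℝ} {Y : ℝ → Tall n} {p : ℕ} {τ : Fin (p + 1) → ℝ} (hτ : StrictMono τ)
    {f : Fin p → ℝ → ℤ}
    (hf : ∀ k, IsBranch ε Y (Set.Icc (τ k.castSucc) (τ k.succ)) (f k)) :
    IsBranch ε Y (Set.Icc (τ 0) (τ (Fin.last p))) (glue τ f) := by
  intro t₀ ht₀
  have hloc : ∀ k : Fin p, ∀ᶠ σ in cofinite, ∀ᶠ t in 𝓝[Set.Icc (τ 0) (τ (Fin.last p))] t₀,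
      f k (max (τ k.castSucc) (min t (τ k.succ))) +
        negIndex (ε • chart σ (Y (max (τ k.castSucc) (min t (τ k.succ))))) =
      f k (max (τ k.castSucc) (min t₀ (τ k.succ))) +
        negIndex (ε • chart σ (Y (max (τ k.castSucc) (min t₀ (τ k.succ))))) := by
    intro k
    have hk : τ k.castSucc < τ k.succ := hτ k.castSucc_lt_succ
    have hm : ∀ t, max (τ k.castSucc) (min t (τ k.succ)) ∈
        Set.Icc (τ k.castSucc) (τ k.succ) :=
      fun t => ⟨le_max_left _ _, max_le hk.le (min_le_right _ _)⟩
    have hc : Continuous fun t => max (τ k.castSucc) (min t (τ k.succ)) := by fun_prop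
    -- Clamping to the `k`-th interval is continuous, so the branch relation at the clamped point
    -- pulls back to `t₀`, even when `t₀` lies outside that interval or is a partition point.
    filter_upwards [hf k _ (hm t₀)] with σ hσ
    have ht : Tendsto (fun t => max (τ k.castSucc) (min t (τ k.succ)))
        (𝓝[Set.Icc (τ 0) (τ (Fin.last p))] t₀)
        (𝓝[Set.Icc (τ k.castSucc) (τ k.succ)] (max (τ k.castSucc) (min t₀ (τ k.succ)))) :=
      tendsto_nhdsWithin_iff.2 ⟨(hc.tendsto t₀).mono_left nhdsWithin_le_nhds,
        Eventually.of_forall hm⟩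
    exact ht.eventually hσ
  filter_upwards [eventually_all.2 hloc] with σ hσ
  filter_upwards [eventually_all.2 hσ, self_mem_nhdsWithin] with t ht hmem
  have e1 := glue_const hτ (fun t => (negIndex (ε • chart σ (Y t)) : ℤ)) hmem
  have e2 := glue_const hτ (fun t => (negIndex (ε • chart σ (Y t)) : ℤ)) ht₀
  have e3 : Osc.glue τ f t + Osc.glue τ (fun _ t => (negIndex (ε • chart σ (Y t)) : ℤ)) t =
      Osc.glue τ f t₀ + Osc.glue τ (fun _ t => (negIndex (ε • chart σ (Y t)) : ℤ)) t₀ := by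
    simp only [Osc.glue, ← Finset.sum_add_distrib]
    refine Finset.sum_congr rfl fun k _ => ?_
    have := ht k
    omega
  omega

/-! ### Invariance under lower block triangular symplectic matrices -/

theorem upper_mul {G : Big n} {K : Matrix (Fin n) (Fin n) ℝ} (hE : G * vertE n = vertE n * K)
    (Y : Tall n) : upper (G * Y) = G.toBlocks₁₁ * upper Y := by
  have h12 : G.toBlocks₁₂ = 0 := by
    have h := congrArg toRows₁ hE
    rw [← fromBlocks_toBlocks G, vertE, fromBlocks_mul_fromRows] at h
    simpa [fromRows_mul] using h
  conv_lhs => rw [← fromBlocks_toBlocks G, ← fromRows_upper_lower Y, fromBlocks_mul_fromRows, h12]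
  simp [upper]

theorem isUnit_toBlocks₁₁ {G : Big n} (hG : IsUnit G.det) {K : Matrix (Fin n) (Fin n) ℝ}
    (hE : G * vertE n = vertE n * K) : IsUnit G.toBlocks₁₁.det := by
  have h12 : G.toBlocks₁₂ = 0 := by
    have h := congrArg toRows₁ hE
    rw [← fromBlocks_toBlocks G, vertE, fromBlocks_mul_fromRows] at h
    simpa [fromRows_mul] using h
  rw [← fromBlocks_toBlocks G, h12, det_fromBlocks_zero₁₂] at hG
  exact isUnit_of_mul_isUnit_left hG

/-- The upper block `X` becomes `H X` with `H` invertible, so `X†X`, and with it `ℳ` and `V`, is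
unchanged. For `𝒫`, the columns of `X̂ V` lie in the range of `X`, whence `(H X)† H X̂ V = X†X X† X̂
V = X† X̂ V`. -/
theorem signedIndex_mul {G : Big n} (hG : G ∈ symplecticGroup (Fin n) ℝ)
    {K : Matrix (Fin n) (Fin n) ℝ} (hE : G * vertE n = vertE n * K) (ε : ℝ) {Y : Tall n}
    (hY : IsLagrangian Y) (Yh : Tall n) :
    signedIndex ε (G * Y) (G * Yh) = signedIndex ε Y Yh := by
  have hH := isUnit_toBlocks₁₁ (symplectic_isUnit hG) hE
  set H := G.toBlocks₁₁
  have hproj : pinv (upper (G * Y)) * upper (G * Y) = pinv (upper Y) * upper Y :=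
    pinv_mul_self_eq (C := H⁻¹) (D := H)
      (by rw [upper_mul hE, ← Matrix.mul_assoc, nonsing_inv_mul _ hH, Matrix.one_mul])
      (upper_mul hE Y).symm
  have hM : calM (G * Y) (G * Yh) = calM Y Yh := by
    rw [calM, calM, hproj, wronskian_symplectic_mul hG]
  have hV : calV (G * Y) (G * Yh) = calV Y Yh := by rw [calV, calV, hM]
  have hP : calP (G * Y) (G * Yh) = calP Y Yh := by
    obtain ⟨s, hs⟩ := hY.eventually_isUnit_shear.exists
    have hR := upper_mul_pinv_mul_calV (Yh := Yh) hY hs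
    rw [calP, calP, hV, wronskian_symplectic_mul hG, Matrix.mul_assoc _ (upper (G * Yh)),
      Matrix.mul_assoc _ (upper Yh), upper_mul hE Yh]
    have e1 : H * upper Yh * calV Y Yh =
        upper (G * Y) * (pinv (upper Y) * (upper Yh * calV Y Yh)) := by
      rw [upper_mul hE Y, Matrix.mul_assoc, Matrix.mul_assoc, ← Matrix.mul_assoc (upper Y), hR]
    rw [e1, Matrix.mul_assoc _ (pinv (upper (G * Y))), ← Matrix.mul_assoc (pinv (upper (G * Y))),
      hproj, ← Matrix.mul_assoc (pinv (upper Y) * upper Y), (pinv_spec _).mul_mul_right,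
      Matrix.mul_assoc _ (pinv (upper Y))]
  rw [signedIndex, signedIndex, hM, hP]

/-! ### Admissible data -/

theorem ContinuousOn.inv_symplectic {s : Set ℝ} {S : ℝ → Big n} (hc : ContinuousOn S s)
    (hS : ∀ t ∈ s, S t ∈ symplecticGroup (Fin n) ℝ) : ContinuousOn (fun t => (S t)⁻¹) s := by
  have h : ContinuousOn (fun t => (-J (Fin n) ℝ) * (S t)ᵀ * J (Fin n) ℝ) s :=
    (continuousOn_const.mul (continuous_id.matrix_transpose.comp_continuousOn hc)).mul
      continuousOn_const
  exact h.congr fun t ht => SymplecticGroup.inv_eq_symplectic_inv _ (hS t ht)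

theorem continuousOn_matrix_mul {l m k : Type*} [Fintype m] {s : Set ℝ}
    {A : ℝ → Matrix l m ℝ} {B : ℝ → Matrix m k ℝ} (hA : ContinuousOn A s) (hB : ContinuousOn B s) :
    ContinuousOn (fun t => A t * B t) s := by
  have h : Continuous fun q : Matrix l m ℝ × Matrix m k ℝ => q.1 * q.2 :=
    continuous_fst.matrix_mul continuous_snd
  exact h.comp_continuousOn (hA.prodMk hB)

theorem IsLagrangianPath.symplectic_inv_mul {a b : ℝ} {Y : ℝ → Tall n}
    (hY : IsLagrangianPath a b Y) {S : ℝ → Big n} (hc : ContinuousOn S (Set.Icc a b))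
    (hS : ∀ t ∈ Set.Icc a b, S t ∈ symplecticGroup (Fin n) ℝ) :
    IsLagrangianPath a b fun t => (S t)⁻¹ * Y t :=
  ⟨continuousOn_matrix_mul (ContinuousOn.inv_symplectic hc hS) hY.1,
    fun t ht => (hY.2 t ht).symplectic_mul (inv_symplectic (hS t ht))⟩

/-- The symplectic matrix with second block column `(I  σI)ᵀ`. -/
def shearBig (n : ℕ) (σ : ℝ) : Big n := fromBlocks 0 1 (-1) (σ • 1)

theorem shearBig_mem (σ : ℝ) : shearBig n σ ∈ symplecticGroup (Fin n) ℝ := by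
  rw [SymplecticGroup.mem_iff]
  simp [shearBig, J, fromBlocks_multiply, fromBlocks_transpose]

theorem shearBig_mul_vertE (σ : ℝ) : shearBig n σ * vertE n = fromRows 1 (σ • 1) := by
  simp [shearBig, vertE, fromBlocks_mul_fromRows]

theorem rank_upper_shearBig_inv_mul {σ : ℝ} {Y : Tall n} (hD : IsUnit (shear σ Y).det) :
    (upper ((shearBig n σ)⁻¹ * Y)).rank = n := by
  have h : wronskian Y (fromRows 1 (σ • 1)) = -(shear σ Y)ᵀ := by
    rw [wronskian_eq]
    simp [upper, lower, shear]
  rw [rank_upper_inv_mul (shearBig_mem σ), shearBig_mul_vertE, h, ← neg_one_smul ℝ,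
    rank_smul_of_ne_zero (by norm_num), rank_transpose]
  simpa using rank_of_isUnit _ ((isUnit_iff_isUnit_det _).2 hD)

/-- Near each point one plane `(I σI)ᵀ` stays transversal to `Y`, so a constant `R` gives both upper
blocks rank `n`. A Lebesgue number makes a uniform partition fine enough. -/
theorem exists_isAdmissible {a b : ℝ} (hab : a < b) {Y : ℝ → Tall n} (hY : IsLagrangianPath a b Y) :
    ∃ (p : ℕ) (τ : Fin (p + 1) → ℝ) (R : Fin p → ℝ → Big n), IsAdmissible a b Y τ R := by
  have hex : ∀ y ∈ Set.Icc a b, ∃ σ, IsUnit (shear σ (Y y)).det :=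
    fun y hy => (hY.2 y hy).eventually_isUnit_shear.exists
  choose! σ hσ using hex
  obtain ⟨δ, hδ, hleb⟩ := Metric.uniformity_basis_dist.lebesgue_number_lemma_nhdsWithin
    (isCompact_Icc (a := a) (b := b)) (U := fun y => {t | IsUnit (shear (σ y) (Y t)).det})
    fun y hy => eventually_isUnit_shear (hY.1 y hy) (hσ y hy)
  obtain ⟨m, hm⟩ := exists_nat_gt ((b - a) / δ)
  have hba : 0 < b - a := sub_pos.2 hab
  have hm0 : (0 : ℝ) < m := lt_of_le_of_lt (by positivity) hm
  have hstep : (b - a) / m < δ := by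
    rw [div_lt_iff₀ hδ] at hm
    rw [div_lt_iff₀ hm0]; linarith
  have hstep0 : 0 < (b - a) / m := by positivity
  let τ : Fin (m + 1) → ℝ := fun i => a + (i : ℝ) * ((b - a) / m)
  have hτ : StrictMono τ := fun i j hij => by
    have : ((i : ℕ) : ℝ) < (j : ℕ) := by exact_mod_cast hij
    simp only [τ]
    nlinarith
  have h0 : τ 0 = a := by simp [τ]
  have hl : τ (Fin.last m) = b := by simp only [τ, Fin.val_last]; field_simp; ring
  have hmem : ∀ i, τ i ∈ Set.Icc a b := fun i =>
    ⟨h0 ▸ hτ.monotone (Fin.zero_le i), hl ▸ hτ.monotone (Fin.le_last i)⟩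
  choose! y hy using hleb
  have hu : ∀ k : Fin m, ∀ t ∈ Set.Icc (τ k.castSucc) (τ k.succ),
      IsUnit (shear (σ (y (τ k.castSucc))) (Y t)).det := by
    intro k t ht
    refine hy _ (hmem k.castSucc) ⟨?_, (hmem _).1.trans ht.1, ht.2.trans (hmem _).2⟩
    have hd : τ k.succ = τ k.castSucc + (b - a) / m := by
      simp only [τ, Fin.val_succ, Fin.val_castSucc]; push_cast; ring
    change dist (τ k.castSucc) t < δ
    rw [dist_comm, Real.dist_eq, abs_of_nonneg (sub_nonneg.2 ht.1)]
    linarith [ht.2]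
  refine ⟨m, τ, fun k _ => shearBig n (σ (y (τ k.castSucc))), h0, hl, hτ,
    fun _ _ _ => shearBig_mem _, fun _ => continuousOn_const, fun k => ⟨n, fun t ht => ?_⟩,
    fun k => ⟨_, fun _ _ => rfl⟩⟩
  exact rank_upper_shearBig_inv_mul (hu k t ht)

/-- The common form of the sums defining the oscillation numbers. -/
def signedSum (ε : ℝ) (Y : ℝ → Tall n) {p : ℕ} (τ : Fin (p + 1) → ℝ) (R : Fin p → ℝ → Big n) : ℤ :=
  ∑ k : Fin p,
    ((signedIndex ε (Y (τ k.succ)) (R k (τ k.succ) * vertE n) : ℤ)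
      - (signedIndex ε (Y (τ k.castSucc)) (R k (τ k.castSucc) * vertE n) : ℤ))

theorem oscSum_eq (Y : ℝ → Tall n) {p : ℕ} (τ : Fin (p + 1) → ℝ) (R : Fin p → ℝ → Big n) :
    oscSum Y τ R = signedSum 1 Y τ R := by
  simp only [oscSum, signedSum, compIndex_eq]

theorem dualOscSum_eq (Y : ℝ → Tall n) {p : ℕ} (τ : Fin (p + 1) → ℝ) (R : Fin p → ℝ → Big n) :
    dualOscSum Y τ R = -signedSum (-1) Y τ R := by
  simp only [dualOscSum, signedSum, dualCompIndex_eq, ← Finset.sum_neg_distrib, neg_sub]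

namespace IsAdmissible

variable {a b : ℝ} {Y : ℝ → Tall n} {p : ℕ} {τ : Fin (p + 1) → ℝ} {R : Fin p → ℝ → Big n}

theorem mem_Icc (h : IsAdmissible a b Y τ R) (i : Fin (p + 1)) : τ i ∈ Set.Icc a b :=
  ⟨h.first ▸ h.strictMono.monotone (Fin.zero_le i), h.last ▸ h.strictMono.monotone (Fin.le_last i)⟩

theorem Icc_subset (h : IsAdmissible a b Y τ R) (k : Fin p) :
    Set.Icc (τ k.castSucc) (τ k.succ) ⊆ Set.Icc a b :=
  Set.Icc_subset_Icc (h.mem_Icc _).1 (h.mem_Icc _).2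

theorem exists_isBranch (h : IsAdmissible a b Y τ R) (hY : IsLagrangianPath a b Y) {ε : ℝ}
    (hε : ε * ε = 1) :
    ∃ F : ℝ → ℤ, IsBranch ε Y (Set.Icc a b) F ∧ F b - F a = signedSum ε Y τ R := by
  let f : Fin p → ℝ → ℤ := fun k t => signedIndex ε (Y t) (R k t * vertE n)
  have hf : ∀ k, IsBranch ε Y (Set.Icc (τ k.castSucc) (τ k.succ)) (f k) := by
    intro k
    refine isBranch_signedIndex hε (hY.1.mono (h.Icc_subset k))
      (fun t ht => hY.2 t (h.Icc_subset k ht))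
      (continuousOn_matrix_mul (h.continuousOn k) continuousOn_const)
      (fun t ht => isLagrangian_vertE.symplectic_mul (h.symplectic k t (h.Icc_subset k ht)))
      ?_ (h.rank_upper k)
    obtain ⟨r, hr⟩ := h.rank_transformed k
    exact ⟨r, fun t ht => by rw [← hr t ht, rank_upper_inv_mul (h.symplectic k t (h.Icc_subset k ht))]⟩
  have hg := IsBranch.glue h.strictMono hf
  rw [h.first, h.last] at hg
  refine ⟨glue τ f, hg, ?_⟩
  rw [← h.first, ← h.last, glue_last h.strictMono, glue_first h.strictMono, sub_zero]
  rfl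

/-- Both sums are increments over `[a, b]` of branches for the same path. -/
theorem signedSum_eq (h : IsAdmissible a b Y τ R) (hY : IsLagrangianPath a b Y) {q : ℕ}
    {τ' : Fin (q + 1) → ℝ} {R' : Fin q → ℝ → Big n} (h' : IsAdmissible a b Y τ' R') {ε : ℝ}
    (hε : ε * ε = 1) : signedSum ε Y τ R = signedSum ε Y τ' R' := by
  obtain ⟨F, hF, hFs⟩ := h.exists_isBranch hY hε
  obtain ⟨G, hG, hGs⟩ := h'.exists_isBranch hY hε
  have hab : a ≤ b := (h.mem_Icc 0).1.trans (h.mem_Icc 0).2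
  rw [← hFs, ← hGs]
  exact hF.sub_eq isPreconnected_Icc hG (Set.right_mem_Icc.2 hab) (Set.left_mem_Icc.2 hab)

theorem isOscillationNumber (h : IsAdmissible a b Y τ R) (hY : IsLagrangianPath a b Y) :
    IsOscillationNumber a b Y (signedSum 1 Y τ R) :=
  ⟨hY, ⟨p, τ, R, h⟩, fun _ _ _ h' => by rw [oscSum_eq, h'.signedSum_eq hY h (by norm_num)]⟩

theorem isDualOscillationNumber (h : IsAdmissible a b Y τ R) (hY : IsLagrangianPath a b Y) :
    IsDualOscillationNumber a b Y (-signedSum (-1) Y τ R) :=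
  ⟨hY, ⟨p, τ, R, h⟩, fun _ _ _ h' => by rw [dualOscSum_eq, h'.signedSum_eq hY h (by norm_num)]⟩

theorem congr (h : IsAdmissible a b Y τ R) {Y' : ℝ → Tall n}
    (hY : ∀ t ∈ Set.Icc a b, Y t = Y' t) : IsAdmissible a b Y' τ R where
  first := h.first
  last := h.last
  strictMono := h.strictMono
  symplectic := h.symplectic
  continuousOn := h.continuousOn
  rank_transformed k := by
    obtain ⟨r, hr⟩ := h.rank_transformed k
    exact ⟨r, fun t ht => by rw [← hY t (h.Icc_subset k ht), hr t ht]⟩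
  rank_upper := h.rank_upper

/-- Transport of admissible data by lower block triangular symplectic matrices. -/
theorem mul (h : IsAdmissible a b Y τ R) {G : ℝ → Big n} (hc : ContinuousOn G (Set.Icc a b))
    (hG : ∀ t ∈ Set.Icc a b, G t ∈ symplecticGroup (Fin n) ℝ)
    (hE : ∀ t ∈ Set.Icc a b, ∃ K, G t * vertE n = vertE n * K) :
    IsAdmissible a b (fun t => G t * Y t) τ fun k t => G t * R k t where
  first := h.first
  last := h.last
  strictMono := h.strictMono
  symplectic k t ht := mul_mem (hG t ht) (h.symplectic k t ht)
  continuousOn k := continuousOn_matrix_mul (hc.mono (h.Icc_subset k)) (h.continuousOn k)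
  rank_transformed k := by
    obtain ⟨r, hr⟩ := h.rank_transformed k
    refine ⟨r, fun t ht => ?_⟩
    rw [← hr t ht, Matrix.mul_inv_rev, Matrix.mul_assoc, ← Matrix.mul_assoc (G t)⁻¹,
      nonsing_inv_mul _ (symplectic_isUnit (hG t (h.Icc_subset k ht))), Matrix.one_mul]
  rank_upper k := by
    obtain ⟨r, hr⟩ := h.rank_upper k
    refine ⟨r, fun t ht => ?_⟩
    have ht' := h.Icc_subset k ht
    obtain ⟨K, hK⟩ := hE t ht'
    rw [← hr t ht, Matrix.mul_assoc, upper_mul hK,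
      rank_mul_eq_right_of_isUnit_det _ _ (isUnit_toBlocks₁₁ (symplectic_isUnit (hG t ht')) hK)]

theorem signedSum_mul (h : IsAdmissible a b Y τ R) (hY : IsLagrangianPath a b Y) {G : ℝ → Big n}
    (hG : ∀ t ∈ Set.Icc a b, G t ∈ symplecticGroup (Fin n) ℝ)
    (hE : ∀ t ∈ Set.Icc a b, ∃ K, G t * vertE n = vertE n * K) (ε : ℝ) :
    signedSum ε (fun t => G t * Y t) τ (fun k t => G t * R k t) = signedSum ε Y τ R := by
  have key : ∀ (k : Fin p) (i : Fin (p + 1)),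
      signedIndex ε (G (τ i) * Y (τ i)) (G (τ i) * R k (τ i) * vertE n) =
        signedIndex ε (Y (τ i)) (R k (τ i) * vertE n) := by
    intro k i
    obtain ⟨K, hK⟩ := hE _ (h.mem_Icc i)
    rw [Matrix.mul_assoc, signedIndex_mul (hG _ (h.mem_Icc i)) hK ε (hY.2 _ (h.mem_Icc i))]
  simp only [signedSum, key]

end IsAdmissible

/-! ### The matrices `Z_Y` -/

section MatZ
open scoped MatrixOrder

theorem normK_spec {Y : Tall n} (hY : IsLagrangian Y) :
    (normK Y)ᵀ = normK Y ∧ normK Y * (Yᵀ * Y) * normK Y = 1 ∧ IsUnit (CFC.sqrt (Yᵀ * Y)).det := by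
  have hpd : (Yᵀ * Y).PosDef := by
    simpa using Matrix.PosDef.conjTranspose_mul_self Y hY.mulVec_injective
  have hQ : (CFC.sqrt (Yᵀ * Y)) * CFC.sqrt (Yᵀ * Y) = Yᵀ * Y :=
    CFC.sqrt_mul_sqrt_self _ hpd.posSemidef.nonneg
  have hQs : (CFC.sqrt (Yᵀ * Y))ᵀ = CFC.sqrt (Yᵀ * Y) := by
    have h := (CFC.sqrt_nonneg (Yᵀ * Y)).posSemidef.isHermitian
    rwa [Matrix.IsHermitian, conjTranspose_eq_transpose_of_trivial] at h
  have hu : IsUnit (CFC.sqrt (Yᵀ * Y)).det := by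
    have h : IsUnit (Yᵀ * Y).det := (isUnit_iff_isUnit_det _).1 hpd.isUnit
    rw [← hQ, det_mul] at h
    exact isUnit_of_mul_isUnit_left h
  refine ⟨by rw [normK, transpose_nonsing_inv, hQs], ?_, hu⟩
  conv_lhs => rw [← hQ]
  rw [normK, ← Matrix.mul_assoc, nonsing_inv_mul _ hu, Matrix.one_mul, mul_nonsing_inv _ hu]

theorem continuousOn_normK {s : Set ℝ} {Y : ℝ → Tall n} (hc : ContinuousOn Y s)
    (hY : ∀ t ∈ s, IsLagrangian (Y t)) : ContinuousOn (fun t => normK (Y t)) s := by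
  have h1 : ContinuousOn (fun t => (Y t)ᵀ * Y t) s :=
    continuousOn_matrix_mul (continuous_id.matrix_transpose.comp_continuousOn hc) hc
  have h2 : ContinuousOn (fun t => CFC.sqrt ((Y t)ᵀ * Y t)) s := by
    open scoped Matrix.Norms.L2Operator in
    refine (CFC.continuousOn_sqrt (A := Matrix (Fin n) (Fin n) ℝ)).comp h1 fun t _ => ?_
    have := Matrix.posSemidef_conjTranspose_mul_self (Y t)
    rw [conjTranspose_eq_transpose_of_trivial] at this
    exact this.nonneg
  intro t ht
  have hu := (normK_spec (hY t ht)).2.2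
  have h3 : ContinuousAt Ring.inverse (CFC.sqrt ((Y t)ᵀ * Y t)).det := by
    obtain ⟨u, hu⟩ := hu
    rw [← hu]
    exact NormedRing.inverse_continuousAt u
  exact ((continuousAt_matrix_inv _ h3).tendsto.comp (h2 t ht) :)

end MatZ

theorem calJ_transpose : (calJ n)ᵀ = -calJ n := by
  simp [calJ, fromBlocks_transpose, fromBlocks_neg]

theorem calJ_mul_calJ : calJ n * calJ n = -1 := by
  simp [calJ, fromBlocks_multiply, ← fromBlocks_one, fromBlocks_neg]

theorem matZ_mem_orthogonalGroup {Y : Tall n} (hY : IsLagrangian Y) :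
    matZ Y ∈ orthogonalGroup (Fin n ⊕ Fin n) ℝ := by
  obtain ⟨hK, hKK, -⟩ := normK_spec hY
  rw [mem_orthogonalGroup_iff']
  change (matZ Y)ᵀ * matZ Y = 1
  rw [matZ, transpose_fromCols, fromRows_mul_fromCols, ← fromBlocks_one]
  have h0 : Yᵀ * (calJ n * Y) = 0 := by rw [← Matrix.mul_assoc]; exact hY.1
  have e : normK Y * (Yᵀ * (Y * normK Y)) = 1 := by simpa [Matrix.mul_assoc] using hKK
  congr 1
  · simp only [transpose_mul, hK, calJ_transpose, Matrix.mul_assoc, Matrix.neg_mul, Matrix.mul_neg]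
    rw [← Matrix.mul_assoc (calJ n) (calJ n), calJ_mul_calJ]
    simpa using e
  · simp only [transpose_mul, hK, calJ_transpose, Matrix.mul_assoc, Matrix.neg_mul, Matrix.mul_neg]
    rw [← Matrix.mul_assoc (calJ n) Y, ← Matrix.mul_assoc Yᵀ, h0]
    simp
  · simp only [transpose_mul, hK, Matrix.mul_assoc]
    rw [← Matrix.mul_assoc (calJ n) Y, ← Matrix.mul_assoc Yᵀ, h0]
    simp
  · simpa only [transpose_mul, hK, Matrix.mul_assoc] using e

theorem matZ_mem_symplecticGroup {Y : Tall n} (hY : IsLagrangian Y) :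
    matZ Y ∈ symplecticGroup (Fin n) ℝ := by
  obtain ⟨hK, hKK, -⟩ := normK_spec hY
  have hJ : J (Fin n) ℝ = -calJ n := by simp [calJ, J, fromBlocks_neg]
  have h0 : Yᵀ * (calJ n * Y) = 0 := by rw [← Matrix.mul_assoc]; exact hY.1
  have e : normK Y * (Yᵀ * (Y * normK Y)) = 1 := by simpa [Matrix.mul_assoc] using hKK
  have hJJ : ∀ B : Matrix (Fin n ⊕ Fin n) (Fin n) ℝ, calJ n * (calJ n * B) = -B := fun B => by
    rw [← Matrix.mul_assoc, calJ_mul_calJ, Matrix.neg_mul, Matrix.one_mul]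
  have h0' : Yᵀ * (calJ n * (Y * normK Y)) = 0 := by
    rw [← Matrix.mul_assoc (calJ n), ← Matrix.mul_assoc, h0, Matrix.zero_mul]
  rw [SymplecticGroup.mem_iff', hJ, Matrix.mul_neg, Matrix.neg_mul, neg_inj, matZ,
    transpose_fromCols, Matrix.mul_assoc, mul_fromCols, fromRows_mul_fromCols, calJ]
  rw [← calJ]
  congr 1
  · simp [transpose_mul, hK, calJ_transpose, Matrix.mul_assoc, hJJ, h0']
  · simp [transpose_mul, hK, calJ_transpose, Matrix.mul_assoc, hJJ, e]
  · simp [transpose_mul, hK, Matrix.mul_assoc, hJJ, e]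
  · simp [transpose_mul, hK, Matrix.mul_assoc, h0']

/-- `Z_Y` maps the vertical plane onto the plane of `Y`; this makes the quotient `S⁻¹ Z_{SE}` lower
block triangular. -/
theorem matZ_mul_vertE (Y : Tall n) : matZ Y * vertE n = Y * normK Y := by
  rw [matZ, vertE, fromCols_mul_fromRows, Matrix.mul_zero, Matrix.mul_one, zero_add]

theorem continuousOn_matZ {s : Set ℝ} {Y : ℝ → Tall n} (hc : ContinuousOn Y s)
    (hY : ∀ t ∈ s, IsLagrangian (Y t)) : ContinuousOn (fun t => matZ (Y t)) s := by
  have hK := continuousOn_normK hc hY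
  have h1 := continuousOn_matrix_mul (continuousOn_matrix_mul
    (continuousOn_const (c := calJ n)) hc) hK
  have h2 := continuousOn_matrix_mul hc hK
  refine continuousOn_pi.2 fun i => continuousOn_pi.2 fun j => ?_
  rcases j with j | j
  · exact continuousOn_pi.1 (continuousOn_pi.1 h1 i) j
  · exact continuousOn_pi.1 (continuousOn_pi.1 h2 i) j

end Osc

end

theorem theoremT (n : ℕ) (a b : ℝ) (hab : a < b)
    (Y : ℝ → Osc.Tall n) (hY : Osc.IsLagrangianPath a b Y)
    (S : ℝ → Osc.Big n) (hS : ContinuousOn S (Set.Icc a b))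
    (hSymp : ∀ t ∈ Set.Icc a b, S t ∈ Matrix.symplecticGroup (Fin n) ℝ) :
    (∀ t ∈ Set.Icc a b,
      Osc.matZ (S t * Osc.vertE n) ∈ Matrix.symplecticGroup (Fin n) ℝ ∧
      Osc.matZ (S t * Osc.vertE n) ∈ Matrix.orthogonalGroup (Fin n ⊕ Fin n) ℝ) ∧
    (∃ N : ℤ,
      Osc.IsOscillationNumber a b (fun t => (S t)⁻¹ * Y t) N ∧
      Osc.IsOscillationNumber a b (fun t => (Osc.matZ (S t * Osc.vertE n))⁻¹ * Y t) N) ∧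
    (∃ N' : ℤ,
      Osc.IsDualOscillationNumber a b (fun t => (S t)⁻¹ * Y t) N' ∧
      Osc.IsDualOscillationNumber a b (fun t => (Osc.matZ (S t * Osc.vertE n))⁻¹ * Y t) N') := by
  open Osc in
  have hSE : ∀ t ∈ Set.Icc a b, IsLagrangian (S t * vertE n) :=
    fun t ht => isLagrangian_vertE.symplectic_mul (hSymp t ht)
  have hZ : ∀ t ∈ Set.Icc a b, matZ (S t * vertE n) ∈ symplecticGroup (Fin n) ℝ :=
    fun t ht => matZ_mem_symplecticGroup (hSE t ht)
  have hZc : ContinuousOn (fun t => matZ (S t * vertE n)) (Set.Icc a b) :=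
    continuousOn_matZ (continuousOn_matrix_mul hS continuousOn_const) hSE
  have hz := hY.symplectic_inv_mul hZc hZ
  have hy := hY.symplectic_inv_mul hS hSymp
  obtain ⟨p, τ, R, h⟩ := exists_isAdmissible hab hz
  -- `G` carries `Z_{SE}⁻¹ Y` to `S⁻¹ Y` and preserves the vertical plane.
  let G : ℝ → Big n := fun t => (S t)⁻¹ * matZ (S t * vertE n)
  have hGc : ContinuousOn G (Set.Icc a b) :=
    continuousOn_matrix_mul (ContinuousOn.inv_symplectic hS hSymp) hZc
  have hG : ∀ t ∈ Set.Icc a b, G t ∈ symplecticGroup (Fin n) ℝ :=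
    fun t ht => mul_mem (inv_symplectic (hSymp t ht)) (hZ t ht)
  have hE : ∀ t ∈ Set.Icc a b, ∃ K, G t * vertE n = vertE n * K := fun t ht =>
    ⟨normK (S t * vertE n), by
      simp only [G]
      rw [Matrix.mul_assoc, matZ_mul_vertE, ← Matrix.mul_assoc, ← Matrix.mul_assoc,
        nonsing_inv_mul _ (symplectic_isUnit (hSymp t ht)), Matrix.one_mul]
      rfl⟩
  have hGz : ∀ t ∈ Set.Icc a b, G t * ((matZ (S t * vertE n))⁻¹ * Y t) = (S t)⁻¹ * Y t := by
    intro t ht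
    simp only [G]
    rw [Matrix.mul_assoc, ← Matrix.mul_assoc (matZ (S t * vertE n)),
      mul_nonsing_inv _ (symplectic_isUnit (hZ t ht)), Matrix.one_mul]
  -- The identity `G Z_{SE}⁻¹ Y = S⁻¹ Y` is available only on `[a, b]`, hence the use of `congr`.
  have h' := (h.mul hGc hG hE).congr hGz
  have hsum : ∀ ε, signedSum ε (fun t => (S t)⁻¹ * Y t) τ (fun k t => G t * R k t) =
      signedSum ε (fun t => (matZ (S t * vertE n))⁻¹ * Y t) τ R := by
    intro ε
    rw [← h.signedSum_mul hz hG hE ε]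
    simp only [signedSum, hGz _ (h.mem_Icc _)]
  refine ⟨fun t ht => ⟨hZ t ht, matZ_mem_orthogonalGroup (hSE t ht)⟩,
    ⟨_, ?_, h.isOscillationNumber hz⟩, ⟨_, ?_, h.isDualOscillationNumber hz⟩⟩
  · rw [← hsum]
    exact h'.isOscillationNumber hy
  · rw [← hsum]
    exact h'.isDualOscillationNumber hy
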